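/- **Theorem 1 (convergence of GTAdam).** *Setting.* Let $N\ge 1$ agents communicate over a directed graph $\mathcal G=(\{1,\dots,N\},\mathcal E,W)$, where $W\in\mathbb R^{N\times N}$ satisfies $w_{ij}>0$ if $(i,j)\in\mathcal E$ and $w_{ij}=0$ otherwise. Assume that $\mathcal G$ is strongly connected and aperiodic (for some $k$, any two agents are joined by a directed walk of length exactly $k$) and that $W$ is doubly stochastic ($\sum_i w_{ij}=1$ for all $j$ and $\sum_j w_{ij}=1$ for all $i$). For $t\in\{0,1,2,\dots\}$ let $f_{i,t}:\mathbb R^n\to\mathbb R$ be the local costs, $f_t=\frac1N\sum_{i=1}^N f_{i,t}$, and let $x_{\star,t}$ be the minimizer of $f_t$ (equivalently of $\sum_i f_{i,t}$). Assume that all $f_{i,t}$ are differentiable with $L$-Lipschitz gradient ($L>0$) and $q$-strongly convex ($q>0$), and that there are $\eta,\zeta>0$ such that, for all $t\ge1$, all $i$ and all $x\in\mathbb R^n$, $$\|\nabla f_{i,t}(x)-\nabla f_{i,t-1}(x)\|\le\eta,\qquad \|x_{\star,t}-x_{\star,t-1}\|\le\zeta .$$ *Algorithm.* Let $\alpha>0$,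 $\beta_1,\beta_2\in(0,1)$, $\epsilon>0$, $G>0$. From arbitrary $x_{i,0}\in\mathbb R^n$, with $s_{i,0}=\nabla f_{i,0}(x_{i,0})$ and $m_{i,0}=v_{i,0}=0$, the GTAdam iterates are, for $t\ge1$ (products, minimum, square root and quotient taken componentwise), $$m_{i,t}=\beta_1m_{i,t-1}+(1-\beta_1)s_{i,t-1},\qquad v_{i,t}=\min\{\beta_2v_{i,t-1}+(1-\beta_2)\,s_{i,t-1}\odot s_{i,t-1},\,G\},$$ $$x_{i,t}=\sum_{j=1}^N w_{ij}x_{j,t-1}-\alpha\frac{m_{i,t}}{\sqrt{v_{i,t}+\epsilon}},\qquad s_{i,t}=\sum_{j=1}^N w_{ij}s_{j,t-1}+\nabla f_{i,t}(x_{i,t})-\nabla f_{i,t-1}(x_{i,t-1}).$$ For $u\in\{x,s,m\}$ put $\bar u_t=\frac1N\sum_i u_{i,t}$ and $D(u_t)=\big(\sum_i\|u_{i,t}-\bar u_t\|^2\big)^{1/2}$, and let $$y_t=\big(\|\bar m_t\|,\ \|\bar s_t-\bar m_t\|,\ D(m_t),\ D(s_t),\ D(x_t),\ \|\bar x_t-x_{\star,t}\|\big)\in\mathbb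 R^6 ,\qquad Q=\frac{L^2\eta^2}{N}+N\eta^2+\zeta^2 .$$ *Claim.* For all sufficiently small $\alpha>0$ there is $\rho(\alpha)\in(0,1)$ such that, for every $t\ge0$, $$f_t(\bar x_t)-f_t(x_{\star,t})\le\frac L2\left(\rho(\alpha)^{2t}\|y_0\|^2+2\rho(\alpha)^t\,\frac{\|y_0\|\sqrt Q}{1-\rho(\alpha)}+\frac{Q}{(1-\rho(\alpha))^2}\right).$$ The threshold on $\alpha$ depends only on $N,\mathcal G,W,L,q,\beta_1,\epsilon,G$, and $\rho(\alpha)$ only on these and $\alpha$; neither depends on the costs, on $\eta,\zeta$, on $\beta_2$, on $n$ or on the initial estimates. -/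

import Mathlib

noncomputable section

namespace GTAdam

/-- The decision space `ℝⁿ` with the Euclidean norm. -/
abbrev Vec (n : ℕ) : Type := EuclideanSpace ℝ (Fin n)

/-! ### Communication network -/

/-- `W` is the weighted adjacency matrix of the directed graph `𝓔`: its weight is positive on every
edge and zero elsewhere. -/
def Compliant {N : ℕ} (𝓔 : Digraph (Fin N)) (W : Matrix (Fin N) (Fin N) ℝ) : Prop :=
  ∀ i j, (𝓔.Adj i j → 0 < W i j) ∧ (¬ 𝓔.Adj i j → W i j = 0)

/-- Every agent can be reached from every other one along directed edges. -/
def StronglyConnected {N : ℕ} (𝓔 : Digraph (Fin N)) : Prop :=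
  ∀ i j, Relation.ReflTransGen 𝓔.Adj i j

/-- There is a directed walk from `i` to `j` with exactly `k` edges. -/
def HasWalk {N : ℕ} (𝓔 : Digraph (Fin N)) : ℕ → Fin N → Fin N → Prop
  | 0, i, j => i = j
  | k + 1, i, j => ∃ l, 𝓔.Adj i l ∧ HasWalk 𝓔 k l j

/-- For some common length `k`, any two agents are joined by a directed walk of length exactly `k`.
For a strongly connected graph this is aperiodicity. -/
def Aperiodic {N : ℕ} (𝓔 : Digraph (Fin N)) : Prop :=
  ∃ k, ∀ i j, HasWalk 𝓔 k i j

/-- All rows and all columns of `W` sum to one. -/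
def RowColSumsOne {N : ℕ} (W : Matrix (Fin N) (Fin N) ℝ) : Prop :=
  (∀ j, ∑ i, W i j = 1) ∧ (∀ i, ∑ j, W i j = 1)

/-! ### Cost functions -/

/-- `g` is differentiable and its gradient is `L`-Lipschitz. -/
def LipschitzGradient {n : ℕ} (L : ℝ) (g : Vec n → ℝ) : Prop :=
  Differentiable ℝ g ∧ ∀ x y, ‖gradient g x - gradient g y‖ ≤ L * ‖x - y‖

/-- The network cost at time `t`, normalized by the number of agents. -/
def cost {N n : ℕ} (f : Fin N → ℕ → Vec n → ℝ) (t : ℕ) (x : Vec n) : ℝ :=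
  (1 / (N : ℝ)) * ∑ i, f i t x

/-- The variation of the local gradients between consecutive times is at most `η`, uniformly over
the agents and over the space, and that of the minimizers `xs` is at most `ζ`. -/
def BoundedVariations {N n : ℕ} (f : Fin N → ℕ → Vec n → ℝ) (xs : ℕ → Vec n) (η ζ : ℝ) : Prop :=
  (∀ t i x, ‖gradient (f i (t + 1)) x - gradient (f i t) x‖ ≤ η) ∧
    ∀ t, ‖xs (t + 1) - xs t‖ ≤ ζ

/-! ### The algorithm -/

/-- Parameters of the algorithm: step-size `α`, momentum parameters `β₁, β₂`, regularization `ε`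
and saturation level `G`. -/
structure Params where
  α : ℝ
  β₁ : ℝ
  β₂ : ℝ
  ε : ℝ
  G : ℝ

/-- For each agent: the solution estimate `x`, the gradient tracker `s` and the estimates `m`, `v`
of the first and second momentum. -/
structure State (N n : ℕ) where
  x : Fin N → Vec n
  s : Fin N → Vec n
  m : Fin N → Vec n
  v : Fin N → Vec n

/-- First momentum update. -/
def nextM {N n : ℕ} (p : Params) (z : State N n) (i : Fin N) : Vec n :=
  p.β₁ • z.m i + (1 - p.β₁) • z.s i

/-- Second momentum update, saturated componentwise at `G`. -/
def nextV {N n : ℕ} (p : Params) (z : State N n) (i : Fin N) : Vec n :=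
  WithLp.toLp 2 fun k => min (p.β₂ * z.v i k + (1 - p.β₂) * (z.s i k * z.s i k)) p.G

/-- Update direction: the componentwise quotient `m / √(v + ε)` with the updated momenta. -/
def direction {N n : ℕ} (p : Params) (z : State N n) (i : Fin N) : Vec n :=
  WithLp.toLp 2 fun k => nextM p z i k / Real.sqrt (nextV p z i k + p.ε)

/-- Solution estimate update. -/
def nextX {N n : ℕ} (W : Matrix (Fin N) (Fin N) ℝ) (p : Params) (z : State N n) (i : Fin N) :
    Vec n :=
  ∑ j, W i j • z.x j - p.α • direction p z i

/-- One iteration, from time `t` to time `t + 1`. -/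
def step {N n : ℕ} (W : Matrix (Fin N) (Fin N) ℝ) (p : Params) (f : Fin N → ℕ → Vec n → ℝ)
    (t : ℕ) (z : State N n) : State N n where
  x := nextX W p z
  s := fun i => ∑ j, W i j • z.s j + gradient (f i (t + 1)) (nextX W p z i) - gradient (f i t) (z.x i)
  m := nextM p z
  v := nextV p z

/-- The iterates, started from the estimates `x₀`. -/
def iterate {N n : ℕ} (W : Matrix (Fin N) (Fin N) ℝ) (p : Params) (f : Fin N → ℕ → Vec n → ℝ)
    (x₀ : Fin N → Vec n) : ℕ → State N n
  | 0 => { x := x₀, s := fun i => gradient (f i 0) (x₀ i), m := 0, v := 0 }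
  | t + 1 => step W p f t (iterate W p f x₀ t)

/-! ### Error quantities -/

/-- The average over the agents. -/
def avg {N n : ℕ} (u : Fin N → Vec n) : Vec n :=
  (1 / (N : ℝ)) • ∑ i, u i

/-- The Euclidean norm of the stacked vector of deviations from the average. -/
def disagreement {N n : ℕ} (u : Fin N → Vec n) : ℝ :=
  Real.sqrt (∑ i, ‖u i - avg u‖ ^ 2)

/-- The vector of the six error quantities of a state relative to the point `xstar`. -/
def errorVec {N n : ℕ} (z : State N n) (xstar : Vec n) : EuclideanSpace ℝ (Fin 6) :=
  !₂[‖avg z.m‖, ‖avg z.s - avg z.m‖, disagreement z.m, disagreement z.s, disagreement z.x,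
    ‖avg z.x - xstar‖]

end GTAdam

end

namespace GTAdam

open Filter Topology
open scoped RealInnerProductSpace

/-! ### Smooth and strongly convex functions -/

section SmoothConvex

variable {E : Type*} [NormedAddCommGroup E] [InnerProductSpace ℝ E] [CompleteSpace E]

/-! On the time scale of a small step-size there is one slow quantity, the square root `a` of the
optimality gap at the average estimate, and one fast quantity `F`, a weighted sum of the
disagreements and of the lag between average tracker and average momentum.

The average tracker always equals the average of the local gradients (`avg_iterate_s`). Up to a
multiple of `F`, every momentum is therefore the gradient of the network cost at the average
estimate. Saturation at `G` and the regularization `ε` keep every preconditioner between `1/√(G+ε)`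
and `1/√ε`, so the average step is a descent direction up to `F`. The Polyak–Łojasiewicz inequality
then gives `a⁺ ≤ (1 - αc) a + αA F + O(η + ζ)` (`sqrt_gap_descent`, `sqrt_gap_drift`). Taking the
root of the gap makes this recursion linear.

Disagreement is measured in an adapted seminorm that each averaging round contracts
(`exists_mixing_seminorm`). With suitable weights, `F⁺ ≤ (1 - δ) F + αB (k a + F) + O(η)` with `δ`
independent of `α` (`weighted_error_contraction`). For small `K` and then small `α`, `a + K F`
contracts by `1 - αc/2` (`coupled_system_bound`).

The claim allows no constant in front of `‖y₀‖`. Smoothness gives `a₀ ≤ √(L/2) ‖x̄₀ - x⋆‖`, and this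
distance is at most `θ ‖y₀‖` with `θ < 1`, because a large distance forces large trackers or a large
disagreement (`norm_avg_sub_minimizer_initial_le`). The slack `1 - θ` absorbs `K F₀`. The constant
in front of `√Q` is absorbed by moving `ρ` closer to one. -/

theorem hasDerivAt_comp_line {g : E → ℝ} (hg : Differentiable ℝ g) (x v : E) (t : ℝ) :
    HasDerivAt (fun t : ℝ => g (x + t • v)) ⟪gradient g (x + t • v), v⟫ t := by
  have h1 : HasDerivAt (fun t : ℝ => x + t • v) v t := by
    simpa using ((hasDerivAt_id t).smul_const v).const_add x
  have h2 := (hg (x + t • v)).hasFDerivAt.comp_hasDerivAt t h1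
  rw [inner_gradient_left]
  exact h2

/-- A function whose gradient is `L`-Lipschitz lies below its quadratic models. -/
theorem le_quadratic_of_lipschitz_gradient {g : E → ℝ} {L : ℝ} (hg : Differentiable ℝ g)
    (hL : ∀ x y, ‖gradient g x - gradient g y‖ ≤ L * ‖x - y‖) (x y : E) :
    g y ≤ g x + ⟪gradient g x, y - x⟫ + L / 2 * ‖y - x‖ ^ 2 := by
  set v := y - x with hv
  have hB : ∀ t : ℝ, HasDerivAt
      (fun t : ℝ => g x + t * ⟪gradient g x, v⟫ + L / 2 * t ^ 2 * ‖v‖ ^ 2)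
      (⟪gradient g x, v⟫ + L * t * ‖v‖ ^ 2) t := by
    intro t
    have h1 : HasDerivAt (fun t : ℝ => t * ⟪gradient g x, v⟫) (1 * ⟪gradient g x, v⟫) t :=
      (hasDerivAt_id t).mul_const _
    have h2 : HasDerivAt (fun t : ℝ => L / 2 * t ^ 2 * ‖v‖ ^ 2)
        (L / 2 * (2 * t) * ‖v‖ ^ 2) t := by
      have := (((hasDerivAt_pow 2 t)).const_mul (L / 2)).mul_const (‖v‖ ^ 2)
      simpa using this
    have := (h1.const_add (g x)).add h2
    exact this.congr_deriv (by ring)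
  have key := image_le_of_deriv_right_le_deriv_boundary (a := 0) (b := 1)
    (f := fun t : ℝ => g (x + t • v)) (f' := fun t => ⟪gradient g (x + t • v), v⟫)
    (fun t _ => (hasDerivAt_comp_line hg x v t).continuousAt.continuousWithinAt)
    (fun t _ => (hasDerivAt_comp_line hg x v t).hasDerivWithinAt)
    (B := fun t : ℝ => g x + t * ⟪gradient g x, v⟫ + L / 2 * t ^ 2 * ‖v‖ ^ 2)
    (B' := fun t => ⟪gradient g x, v⟫ + L * t * ‖v‖ ^ 2) (by simp)
    (fun t _ => (hB t).continuousAt.continuousWithinAt)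
    (fun t _ => (hB t).hasDerivWithinAt) (by
      intro t ht
      have h1 : ⟪gradient g (x + t • v) - gradient g x, v⟫ ≤ L * t * ‖v‖ ^ 2 := by
        refine (real_inner_le_norm _ _).trans ?_
        have h2 := hL (x + t • v) x
        rw [add_sub_cancel_left, norm_smul, Real.norm_of_nonneg ht.1] at h2
        nlinarith [mul_le_mul_of_nonneg_right h2 (norm_nonneg v)]
      rw [inner_sub_left] at h1
      linarith)
  have := key (Set.right_mem_Icc.2 zero_le_one)
  simpa [hv] using this

/-- A differentiable strongly convex function lies above its quadratic models. -/
theorem quadratic_le_of_strongConvexOn {g : E → ℝ} {q : ℝ} (hg : Differentiable ℝ g)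
    (hq : StrongConvexOn Set.univ q g) (x y : E) :
    g x + ⟪gradient g x, y - x⟫ + q / 2 * ‖y - x‖ ^ 2 ≤ g y := by
  have h1 := (hasDerivAt_comp_line hg x (y - x) 0).tendsto_slope_zero_right
  simp only [zero_add, zero_smul, add_zero, smul_eq_mul] at h1
  -- Strong convexity at `x + t (y - x)`, divided by `t`, bounds the difference quotient; as `t →
  -- 0⁺` the factor `1 - t` disappears and the full modulus `q` survives.
  have h2 : Tendsto (fun t : ℝ => g y - g x - (1 - t) * (q / 2 * ‖y - x‖ ^ 2)) (𝓝[>] 0)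
      (𝓝 (g y - g x - (1 - 0) * (q / 2 * ‖y - x‖ ^ 2))) :=
    Tendsto.mono_left (Continuous.tendsto (by fun_prop) 0) nhdsWithin_le_nhds
  have h3 := le_of_tendsto_of_tendsto h1 h2 (by
    filter_upwards [Ioo_mem_nhdsGT (zero_lt_one (α := ℝ))] with t ht
    have h4 := hq.2 (Set.mem_univ x) (Set.mem_univ y) (sub_nonneg.2 ht.2.le) ht.1.le
      (by ring)
    have h5 : (1 - t) • x + t • y = x + t • (y - x) := by
      rw [sub_smul, smul_sub, one_smul]; abel
    rw [h5, norm_sub_rev x y] at h4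
    simp only [smul_eq_mul] at h4
    rw [inv_mul_le_iff₀ ht.1]
    nlinarith [h4])
  linarith

theorem gradient_eq_zero_of_isMinOn {g : E → ℝ} {x : E} (h : IsMinOn g Set.univ x) :
    gradient g x = 0 := by
  have h1 : IsLocalMin g x := h.isLocalMin univ_mem
  simp [gradient, h1.fderiv_eq_zero]

/-- The quadratic growth of a strongly convex function away from its minimizer. -/
theorem sq_norm_sub_minimizer_le {g : E → ℝ} {q : ℝ} {xs : E} (hg : Differentiable ℝ g)
    (hq : StrongConvexOn Set.univ q g) (hmin : IsMinOn g Set.univ xs) (x : E) :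
    q / 2 * ‖x - xs‖ ^ 2 ≤ g x - g xs := by
  have := quadratic_le_of_strongConvexOn hg hq xs x
  rw [gradient_eq_zero_of_isMinOn hmin, inner_zero_left] at this
  linarith

/-- The Polyak–Łojasiewicz inequality. -/
theorem sub_le_sq_norm_gradient {g : E → ℝ} {q : ℝ} (hq0 : 0 < q) (hg : Differentiable ℝ g)
    (hq : StrongConvexOn Set.univ q g) (x y : E) :
    2 * q * (g x - g y) ≤ ‖gradient g x‖ ^ 2 := by
  have h1 := quadratic_le_of_strongConvexOn hg hq x y
  have h2 := neg_le_of_abs_le (abs_real_inner_le_norm (gradient g x) (y - x))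
  have h3 : g x - g y ≤ ‖gradient g x‖ * ‖y - x‖ - q / 2 * ‖y - x‖ ^ 2 := by linarith
  -- The right side of `h3` is a quadratic in `‖y - x‖` with maximum `‖gradient g x‖² / (2q)`.
  nlinarith [sq_nonneg (‖gradient g x‖ - q * ‖y - x‖)]

/-- The gap lies between `q/2 ‖x - xs‖²` (growth) and `‖gradient g x‖² / (2q)` (Polyak–Łojasiewicz).
-/
theorem mul_norm_sub_minimizer_le_norm_gradient {g : E → ℝ} {q : ℝ} {xs : E} (hq0 : 0 < q)
    (hg : Differentiable ℝ g) (hq : StrongConvexOn Set.univ q g)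
    (hmin : IsMinOn g Set.univ xs) (x : E) :
    q * ‖x - xs‖ ≤ ‖gradient g x‖ := by
  have h1 := sq_norm_sub_minimizer_le hg hq hmin x
  have h2 := sub_le_sq_norm_gradient hq0 hg hq x xs
  refine abs_le_of_sq_le_sq' ?_ (norm_nonneg _) |>.2
  nlinarith

/-- The optimality gaps of two smooth functions with close gradients and close minimizers differ
by little. -/
theorem gap_drift {g g' : E → ℝ} {L η : ℝ} {xs xs' : E} (hg : Differentiable ℝ g)
    (hg' : Differentiable ℝ g')
    (hL : ∀ x y, ‖gradient g' x - gradient g' y‖ ≤ L * ‖x - y‖)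
    (hmin' : IsMinOn g' Set.univ xs')
    (hη : ∀ x, ‖gradient g' x - gradient g x‖ ≤ η) (x : E) :
    g' x - g' xs' ≤ g x - g xs + η * ‖x - xs‖ + L / 2 * ‖xs' - xs‖ ^ 2 := by
  -- The difference `g' - g` is `η`-Lipschitz, so only its increment between `xs` and `x` enters;
  -- what is left is the gap of `g'` at `xs`, quadratic in the shift of the minimizer.
  have h1 : ‖(g' x - g x) - (g' xs - g xs)‖ ≤ η * ‖x - xs‖ := by
    refine Convex.norm_image_sub_le_of_norm_fderiv_le (𝕜 := ℝ) (f := fun x => g' x - g x)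
      (s := Set.univ) (fun y _ => (hg' y).sub (hg y)) (fun y _ => ?_) convex_univ
      (Set.mem_univ _) (Set.mem_univ _)
    rw [fderiv_fun_sub (hg' y) (hg y), ← toDual_gradient, ← toDual_gradient, ← map_sub,
      LinearIsometryEquiv.norm_map]
    exact hη y
  have h2 := le_quadratic_of_lipschitz_gradient hg' hL xs' xs
  rw [gradient_eq_zero_of_isMinOn hmin', inner_zero_left, norm_sub_rev] at h2
  have h3 := (le_abs_self _).trans h1
  linarith

end SmoothConvex

/-! ### The network cost -/

section Cost

variable {N n : ℕ}

theorem hasGradientAt_cost {f : Fin N → ℕ → Vec n → ℝ} {t : ℕ}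
    (hf : ∀ i, Differentiable ℝ (f i t)) (x : Vec n) :
    HasGradientAt (cost f t) (avg fun i => gradient (f i t) x) x := by
  rw [hasGradientAt_iff_hasFDerivAt]
  have h := (HasFDerivAt.fun_sum (u := Finset.univ)
    fun i _ => (hf i x).hasFDerivAt).const_mul (1 / (N : ℝ))
  refine h.congr_fderiv ?_
  simp [avg, map_sum, toDual_gradient]

theorem gradient_cost {f : Fin N → ℕ → Vec n → ℝ} {t : ℕ}
    (hf : ∀ i, Differentiable ℝ (f i t)) (x : Vec n) :
    gradient (cost f t) x = avg fun i => gradient (f i t) x :=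
  (hasGradientAt_cost hf x).gradient

theorem avg_sub (u w : Fin N → Vec n) : avg (fun i => u i - w i) = avg u - avg w := by
  simp [avg, Finset.sum_sub_distrib, smul_sub]

theorem avg_add (u w : Fin N → Vec n) : avg (fun i => u i + w i) = avg u + avg w := by
  simp [avg, Finset.sum_add_distrib, smul_add]

theorem avg_smul (c : ℝ) (u : Fin N → Vec n) : avg (fun i => c • u i) = c • avg u := by
  simp [avg, ← Finset.smul_sum, smul_comm c]

theorem avg_const (hN : 0 < N) (c : Vec n) : avg (fun _ : Fin N => c) = c := by
  have : (N : ℝ) ≠ 0 := by positivity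
  simp [avg, ← Nat.cast_smul_eq_nsmul ℝ, smul_smul, this]

theorem norm_avg_le (hN : 0 < N) {u : Fin N → Vec n} {B : ℝ} (h : ∀ i, ‖u i‖ ≤ B) :
    ‖avg u‖ ≤ B := by
  have hN' : (0 : ℝ) < N := by positivity
  rw [avg, norm_smul, Real.norm_of_nonneg (by positivity), one_div, inv_mul_le_iff₀ hN']
  refine (norm_sum_le _ _).trans ((Finset.sum_le_sum fun i _ => h i).trans ?_)
  simp

theorem LipschitzGradient.cost (hN : 0 < N) {L : ℝ} {f : Fin N → ℕ → Vec n → ℝ} {t : ℕ}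
    (hf : ∀ i, LipschitzGradient L (f i t)) : LipschitzGradient L (cost f t) := by
  refine ⟨fun x => (hasGradientAt_cost (fun i => (hf i).1) x).differentiableAt, fun x y => ?_⟩
  rw [gradient_cost fun i => (hf i).1, gradient_cost fun i => (hf i).1, ← avg_sub]
  exact norm_avg_le hN fun i => (hf i).2 x y

theorem strongConvexOn_cost (hN : 0 < N) {q : ℝ} {f : Fin N → ℕ → Vec n → ℝ} {t : ℕ}
    (hf : ∀ i, StrongConvexOn Set.univ q (f i t)) : StrongConvexOn Set.univ q (cost f t) := by
  refine ⟨convex_univ, fun x _ y _ a b ha hb hab => ?_⟩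
  have hN' : (0 : ℝ) < N := by positivity
  have h := Finset.sum_le_sum fun i (_ : i ∈ Finset.univ) =>
    (hf i).2 (Set.mem_univ x) (Set.mem_univ y) ha hb hab
  simp only [Finset.sum_sub_distrib, Finset.sum_add_distrib, smul_eq_mul, ← Finset.mul_sum,
    Finset.sum_const, Finset.card_univ, Fintype.card_fin, nsmul_eq_mul] at h
  have h' := mul_le_mul_of_nonneg_left h (by positivity : 0 ≤ 1 / (N : ℝ))
  refine h'.trans_eq ?_
  simp only [GTAdam.cost, smul_eq_mul]
  field_simp

end Cost

end GTAdam

noncomputable section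

namespace GTAdam

/-! ### Averaging over the network -/

section Mixing

variable {N n : ℕ}

/-- One round of averaging with the weights `W`. -/
def mix (W : Matrix (Fin N) (Fin N) ℝ) : (Fin N → Vec n) →ₗ[ℝ] (Fin N → Vec n) where
  toFun u i := ∑ j, W i j • u j
  map_add' u w := by ext1 i; simp [smul_add, Finset.sum_add_distrib]
  map_smul' c u := by ext1 i; simp [Finset.smul_sum, smul_comm c]

theorem mix_apply (W : Matrix (Fin N) (Fin N) ℝ) (u : Fin N → Vec n) (i : Fin N) :
    mix W u i = ∑ j, W i j • u j := rfl

theorem mix_mul (A B : Matrix (Fin N) (Fin N) ℝ) (u : Fin N → Vec n) :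
    mix (A * B) u = mix A (mix B u) := by
  ext1 i
  simp only [mix_apply, Matrix.mul_apply, Finset.sum_smul, Finset.smul_sum, smul_smul]
  exact Finset.sum_comm

theorem mix_one (u : Fin N → Vec n) : mix 1 u = u := by
  ext1 i
  simp [mix_apply, Matrix.one_apply]

theorem avg_mix {W : Matrix (Fin N) (Fin N) ℝ} (hcol : ∀ j, ∑ i, W i j = 1)
    (u : Fin N → Vec n) : avg (mix W u) = avg u := by
  simp only [avg, mix_apply]
  rw [Finset.sum_comm]
  simp [← Finset.sum_smul, hcol]

theorem mix_const {W : Matrix (Fin N) (Fin N) ℝ} (hrow : ∀ i, ∑ j, W i j = 1) (c : Vec n) :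
    mix W (fun _ => c) = fun _ => c := by
  ext1 i
  simp [mix_apply, ← Finset.sum_smul, hrow]

/-- Deviation from the average. -/
def center : (Fin N → Vec n) →ₗ[ℝ] (Fin N → Vec n) where
  toFun u i := u i - avg u
  map_add' u w := by
    ext1 i
    have : avg (u + w) = avg u + avg w := avg_add u w
    simp only [Pi.add_apply, this]
    abel
  map_smul' c u := by
    ext1 i
    have : avg (c • u) = c • avg u := avg_smul c u
    simp only [Pi.smul_apply, this, RingHom.id_apply, smul_sub]

theorem center_apply (u : Fin N → Vec n) (i : Fin N) : center u i = u i - avg u := rfl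

theorem avg_center (hN : 0 < N) (u : Fin N → Vec n) : avg (center u) = 0 := by
  have : avg (center u) = avg u - avg (fun _ : Fin N => avg u) := avg_sub u _
  rw [this, avg_const hN, sub_self]

/-- Row sums make averaging fix constants, column sums make it preserve the average; centering needs
both. -/
theorem center_mix {W : Matrix (Fin N) (Fin N) ℝ} (hsums : RowColSumsOne W)
    (u : Fin N → Vec n) : center (mix W u) = mix W (center u) := by
  have h : center u = u - fun _ => avg u := rfl
  rw [h, map_sub, mix_const hsums.2]
  ext1 i
  simp [center_apply, avg_mix hsums.1]

theorem norm_center_le (hN : 0 < N) (u : Fin N → Vec n) : ‖center u‖ ≤ 2 * ‖u‖ := by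
  refine (pi_norm_le_iff_of_nonneg (by positivity)).2 fun i => ?_
  have h1 := norm_sub_le (u i) (avg u)
  have h2 := norm_le_pi_norm u i
  have h3 : ‖avg u‖ ≤ ‖u‖ := norm_avg_le hN fun i => norm_le_pi_norm u i
  rw [center_apply]
  linarith

/-- Here `‖u‖` is the maximum over the agents, so only row sums matter and the dimension `n` never
enters. -/
theorem norm_mix_le {A : Matrix (Fin N) (Fin N) ℝ} {c : ℝ} (hA : ∀ i j, 0 ≤ A i j)
    (hrow : ∀ i, ∑ j, A i j ≤ c) (hc : 0 ≤ c) (u : Fin N → Vec n) : ‖mix A u‖ ≤ c * ‖u‖ := by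
  refine (pi_norm_le_iff_of_nonneg (by positivity)).2 fun i => ?_
  rw [mix_apply]
  calc ‖∑ j, A i j • u j‖ ≤ ∑ j, ‖A i j • u j‖ := norm_sum_le _ _
    _ ≤ ∑ j, A i j * ‖u‖ := Finset.sum_le_sum fun j _ => by
        rw [norm_smul, Real.norm_of_nonneg (hA i j)]
        exact mul_le_mul_of_nonneg_left (norm_le_pi_norm u j) (hA i j)
    _ = (∑ j, A i j) * ‖u‖ := (Finset.sum_mul ..).symm
    _ ≤ c * ‖u‖ := mul_le_mul_of_nonneg_right (hrow i) (norm_nonneg u)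

/-- A stochastic matrix with entries at least `δ` contracts vectors of zero average. -/
theorem norm_mix_le_of_avg_eq_zero (hN : 0 < N) {A : Matrix (Fin N) (Fin N) ℝ} {δ : ℝ}
    (hδ : 0 ≤ δ) (hδ' : δ ≤ 1) (hA : ∀ i j, δ ≤ A i j) (hrow : ∀ i, ∑ j, A i j = 1)
    {u : Fin N → Vec n} (hu : avg u = 0) : ‖mix A u‖ ≤ (1 - δ) * ‖u‖ := by
  have hN' : (1 : ℝ) ≤ N := by exact_mod_cast hN
  have hsum : ∑ j, u j = 0 := by
    have : (1 / (N : ℝ)) ≠ 0 := by positivity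
    exact (smul_eq_zero.1 hu).resolve_left this
  -- Subtracting `δ` from every entry does not change the action on vectors of zero sum, but lowers
  -- each row sum to `1 - N δ ≤ 1 - δ`.
  have h : mix A u = mix (Matrix.of fun i j => A i j - δ) u := by
    ext1 i
    simp only [mix_apply, Matrix.of_apply, sub_smul, Finset.sum_sub_distrib, ← Finset.smul_sum,
      hsum, smul_zero, sub_zero]
  rw [h]
  refine norm_mix_le (fun i j => sub_nonneg.2 (hA i j)) (fun i => ?_) (by linarith) u
  simp only [Finset.sum_sub_distrib, hrow, Finset.sum_const, Finset.card_univ, Fintype.card_fin,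
    nsmul_eq_mul]
  nlinarith

theorem Compliant.nonneg {𝓔 : Digraph (Fin N)} {W : Matrix (Fin N) (Fin N) ℝ}
    (hW : Compliant 𝓔 W) (i j : Fin N) : 0 ≤ W i j := by
  by_cases h : 𝓔.Adj i j
  · exact ((hW i j).1 h).le
  · exact ((hW i j).2 h).ge

theorem pow_nonneg_entries {W : Matrix (Fin N) (Fin N) ℝ} (hW : ∀ i j, 0 ≤ W i j) (k : ℕ) :
    ∀ i j, 0 ≤ (W ^ k) i j := by
  induction k with
  | zero => intro i j; rw [pow_zero, Matrix.one_apply]; split_ifs <;> norm_num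
  | succ k ih =>
    intro i j
    rw [pow_succ', Matrix.mul_apply]
    exact Finset.sum_nonneg fun l _ => mul_nonneg (hW i l) (ih l j)

theorem pow_pos_of_hasWalk {𝓔 : Digraph (Fin N)} {W : Matrix (Fin N) (Fin N) ℝ}
    (hW : Compliant 𝓔 W) (k : ℕ) : ∀ i j, HasWalk 𝓔 k i j → 0 < (W ^ k) i j := by
  induction k with
  | zero => rintro i j (rfl : i = j); simp
  | succ k ih =>
    rintro i j ⟨l, hil, hlj⟩
    rw [pow_succ', Matrix.mul_apply]
    exact Finset.sum_pos' (fun l _ => mul_nonneg (hW.nonneg i l) (pow_nonneg_entries hW.nonneg k l j))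
      ⟨l, Finset.mem_univ l, mul_pos ((hW i l).1 hil) (ih l j hlj)⟩

theorem pow_row_sum {W : Matrix (Fin N) (Fin N) ℝ} (hrow : ∀ i, ∑ j, W i j = 1) (k : ℕ) :
    ∀ i, ∑ j, (W ^ k) i j = 1 := by
  induction k with
  | zero => intro i; simp [Matrix.one_apply]
  | succ k ih =>
    intro i
    simp only [pow_succ', Matrix.mul_apply]
    rw [Finset.sum_comm]
    simp [← Finset.mul_sum, ih, hrow]

/-- Some positive power of the weight matrix of an aperiodic graph has all entries bounded away
from zero. -/
theorem exists_pow_entries_ge {𝓔 : Digraph (Fin N)} {W : Matrix (Fin N) (Fin N) ℝ}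
    (hW : Compliant 𝓔 W) (haper : Aperiodic 𝓔) (hrow : ∀ i, ∑ j, W i j = 1) :
    ∃ K : ℕ, ∃ δ : ℝ, 0 < K ∧ 0 < δ ∧ δ < 1 ∧ ∀ i j, δ ≤ (W ^ K) i j := by
  obtain ⟨k, hk⟩ := haper
  -- One extra factor makes the exponent positive even if `k = 0`; entries stay positive since every
  -- row of `W` has a positive entry.
  have hpos : ∀ i j, 0 < (W ^ (k + 1)) i j := by
    intro i j
    rw [pow_succ', Matrix.mul_apply]
    have hne : ∃ l ∈ Finset.univ, W i l ≠ 0 :=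
      Finset.exists_ne_zero_of_sum_ne_zero (by rw [hrow i]; exact one_ne_zero)
    obtain ⟨l, -, hl⟩ := hne
    exact Finset.sum_pos' (fun l _ => mul_nonneg (hW.nonneg i l) (pow_nonneg_entries hW.nonneg k l j))
      ⟨l, Finset.mem_univ l, mul_pos (lt_of_le_of_ne (hW.nonneg i l) hl.symm)
        (pow_pos_of_hasWalk hW k l j (hk l j))⟩
  obtain ⟨δ, hδ, hδ'⟩ : ∃ δ : ℝ, 0 < δ ∧ ∀ x : Fin N × Fin N, δ ≤ (W ^ (k + 1)) x.1 x.2 := by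
    rcases isEmpty_or_nonempty (Fin N × Fin N) with h | h
    · exact ⟨1, one_pos, fun x => h.elim x⟩
    · obtain ⟨x, hx⟩ := Finite.exists_min fun x : Fin N × Fin N => (W ^ (k + 1)) x.1 x.2
      exact ⟨_, hpos x.1 x.2, hx⟩
  exact ⟨k + 1, min δ (1 / 2), k.succ_pos, by positivity, (min_le_right _ _).trans_lt (by norm_num),
    fun i j => (min_le_left _ _).trans (hδ' (i, j))⟩

/-- A seminorm measuring disagreement which is contracted by every round of averaging, with
constants that do not depend on the dimension of the decision space. -/
theorem exists_mixing_seminorm (hN : 0 < N) {𝓔 : Digraph (Fin N)}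
    {W : Matrix (Fin N) (Fin N) ℝ} (hW : Compliant 𝓔 W) (haper : Aperiodic 𝓔)
    (hsums : RowColSumsOne W) :
    ∃ τ C : ℝ, 0 < τ ∧ τ < 1 ∧ 0 < C ∧ ∀ n, ∃ p : Seminorm ℝ (Fin N → Vec n),
      (∀ u, p (mix W u) ≤ τ * p u) ∧ (∀ u, p u ≤ C * ‖u‖) ∧ (∀ u i, ‖u i - avg u‖ ≤ p u) ∧
        ∀ u, p u = p (center u) := by
  obtain ⟨K, δ, hK, hδ, hδ', hWK⟩ := exists_pow_entries_ge hW haper hsums.2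
  set τ : ℝ := (1 - δ) ^ ((K : ℝ)⁻¹) with hτ
  have hτ0 : 0 < τ := Real.rpow_pos_of_pos (by linarith) _
  have hτ1 : τ < 1 := Real.rpow_lt_one (by linarith) (by linarith) (by positivity)
  have hτK : τ ^ K = 1 - δ := Real.rpow_inv_natCast_pow (by linarith) hK.ne'
  have hmix : ∀ (n k : ℕ) (u : Fin N → Vec n), ‖mix (W ^ k) u‖ ≤ ‖u‖ := fun n k u => by
    simpa using norm_mix_le (pow_nonneg_entries hW.nonneg k)
      (fun i => (pow_row_sum hsums.2 k i).le) zero_le_one u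
  refine ⟨τ, 2 * ∑ k ∈ Finset.range K, τ⁻¹ ^ k, hτ0, hτ1,
    mul_pos two_pos (Finset.sum_pos (fun k _ => by positivity) ⟨0, by simpa using hK⟩), fun n => ?_⟩
  -- Adapted norm: one averaging round shifts the terms `φ k` by one index at the price of `τ`, and
  -- the term `φ K` that appears is at most the lost `φ 0`, because `τ ^ K = 1 - δ`.
  set φ : ℕ → (Fin N → Vec n) → ℝ := fun k u => τ⁻¹ ^ k * ‖mix (W ^ k) (center u)‖ with hφ
  have hφ0 : ∀ k u, 0 ≤ φ k u := fun k u => by positivity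
  let p : Seminorm ℝ (Fin N → Vec n) := Seminorm.of (fun u => ∑ k ∈ Finset.range K, φ k u)
    (fun u w => by
      rw [← Finset.sum_add_distrib]
      refine Finset.sum_le_sum fun k _ => ?_
      simp only [hφ, map_add, ← mul_add]
      exact mul_le_mul_of_nonneg_left (norm_add_le _ _) (by positivity))
    (fun c u => by
      rw [Finset.mul_sum]
      refine Finset.sum_congr rfl fun k _ => ?_
      simp only [hφ, map_smul, norm_smul]
      ring)
  have hp : ∀ u, p u = ∑ k ∈ Finset.range K, φ k u := fun u => rfl
  refine ⟨p, fun u => ?_, fun u => ?_, fun u i => ?_, fun u => ?_⟩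
  · have h1 : ∀ k, φ k (mix W u) = τ * φ (k + 1) u := fun k => by
      simp only [hφ, center_mix hsums, ← mix_mul, ← pow_succ]
      rw [pow_succ τ⁻¹]
      field_simp
    have h2 : φ K u ≤ φ 0 u := by
      simp only [hφ, pow_zero, mix_one, inv_pow, hτK, inv_one, one_mul]
      rw [inv_mul_le_iff₀ (by linarith)]
      exact norm_mix_le_of_avg_eq_zero hN hδ.le hδ'.le hWK (pow_row_sum hsums.2 K)
        (avg_center hN u)
    rw [hp, hp]
    simp only [h1, ← Finset.mul_sum]
    refine mul_le_mul_of_nonneg_left ?_ hτ0.le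
    have h3 := Finset.sum_range_succ (fun k => φ k u) K
    rw [Finset.sum_range_succ'] at h3
    linarith
  · rw [hp, Finset.mul_sum, Finset.sum_mul]
    refine Finset.sum_le_sum fun k _ => ?_
    rw [mul_comm 2, mul_assoc]
    exact mul_le_mul_of_nonneg_left ((hmix n k (center u)).trans (norm_center_le hN u))
      (by positivity)
  · have h1 : φ 0 u ≤ p u := Finset.single_le_sum (f := fun k => φ k u) (fun k _ => hφ0 k u)
      (Finset.mem_range.2 hK)
    simp only [hφ, pow_zero, one_mul, mix_one] at h1
    exact (norm_le_pi_norm (center u) i).trans h1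
  · have h1 : center (center u) = center u := by
      ext1 i
      rw [center_apply, avg_center hN, sub_zero]
    simp only [hp, hφ, h1]

theorem norm_center_le_disagreement (u : Fin N → Vec n) : ‖center u‖ ≤ disagreement u := by
  refine (pi_norm_le_iff_of_nonneg (Real.sqrt_nonneg _)).2 fun i => Real.le_sqrt_of_sq_le ?_
  exact Finset.single_le_sum (f := fun i => ‖u i - avg u‖ ^ 2) (fun i _ => by positivity)
    (Finset.mem_univ i)

end Mixing

end GTAdam

end

noncomputable section

namespace GTAdam

open scoped RealInnerProductSpace

/-! ### Descent of the optimality gap along a preconditioned gradient -/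

section Descent

variable {E : Type*} [NormedAddCommGroup E] [InnerProductSpace ℝ E] [CompleteSpace E]

theorem norm_sub_minimizer_le_sqrt_gap {g : E → ℝ} {q : ℝ} {xs : E} (hq0 : 0 < q)
    (hg : Differentiable ℝ g) (hq : StrongConvexOn Set.univ q g) (hmin : IsMinOn g Set.univ xs)
    (x : E) : ‖x - xs‖ ≤ Real.sqrt (2 / q) * Real.sqrt (g x - g xs) := by
  rw [← Real.sqrt_mul (by positivity)]
  refine Real.le_sqrt_of_sq_le ?_
  have := sq_norm_sub_minimizer_le hg hq hmin x
  rw [div_mul_eq_mul_div, le_div_iff₀ hq0]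
  linarith

theorem norm_gradient_le_sqrt_gap {g : E → ℝ} {L q : ℝ} {xs : E} (hL : 0 ≤ L) (hq0 : 0 < q)
    (hg : Differentiable ℝ g) (hlip : ∀ x y, ‖gradient g x - gradient g y‖ ≤ L * ‖x - y‖)
    (hq : StrongConvexOn Set.univ q g) (hmin : IsMinOn g Set.univ xs) (x : E) :
    ‖gradient g x‖ ≤ L * Real.sqrt (2 / q) * Real.sqrt (g x - g xs) := by
  have h1 := hlip x xs
  rw [gradient_eq_zero_of_isMinOn hmin, sub_zero] at h1
  rw [mul_assoc]
  exact h1.trans (mul_le_mul_of_nonneg_left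
    (norm_sub_minimizer_le_sqrt_gap hq0 hg hq hmin x) hL)

/-- Completes the bound on the gap to a perfect square so that its root can be taken: `1 - 2αc ≤ (1
- αc)²`, and the cross term fits into the double product because `2 (1 - αc) ≥ 1`. -/
theorem descent_le_sq {α c d₁ k L a r : ℝ} (hα : 0 < α) (hL : 0 < L) (hd₁ : 0 < d₁) (hk : 0 ≤ k)
    (ha : 0 ≤ a) (hr : 0 ≤ r) (hαc : α * c ≤ 1 / 2) :
    a ^ 2 - 2 * (α * c) * a ^ 2 + α * d₁ * r * (k * a) + α ^ 2 * L * d₁ ^ 2 * r ^ 2 ≤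
      ((1 - α * c) * a + α * ((k + L + 1) * d₁) * r) ^ 2 := by
  have e1 : (1 - 2 * (α * c)) * a ^ 2 ≤ (1 - α * c) ^ 2 * a ^ 2 := by
    gcongr
    nlinarith [sq_nonneg (α * c)]
  have e2 : α * d₁ * r * (k * a) ≤ 2 * (1 - α * c) * (α * d₁ * r * ((k + L + 1) * a)) :=
    calc α * d₁ * r * (k * a) ≤ 1 * (α * d₁ * r * ((k + L + 1) * a)) := by
          rw [one_mul]; gcongr; linarith
      _ ≤ 2 * (1 - α * c) * (α * d₁ * r * ((k + L + 1) * a)) := by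
          gcongr; linarith
  have e3 : α ^ 2 * L * d₁ ^ 2 * r ^ 2 ≤ (α * ((k + L + 1) * d₁) * r) ^ 2 := by
    have : L ≤ (k + L + 1) ^ 2 := by nlinarith
    calc α ^ 2 * L * d₁ ^ 2 * r ^ 2 ≤ α ^ 2 * (k + L + 1) ^ 2 * d₁ ^ 2 * r ^ 2 := by gcongr
      _ = _ := by ring
  calc _ ≤ (1 - α * c) ^ 2 * a ^ 2 + 2 * (1 - α * c) * (α * d₁ * r * ((k + L + 1) * a))
        + (α * ((k + L + 1) * d₁) * r) ^ 2 := by linarith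
    _ = _ := by ring

/-- A step along a direction `w` which agrees with a preconditioned gradient up to an error `r`
contracts the square root of the optimality gap, up to a multiple of `r`. -/
theorem sqrt_gap_descent {g : E → ℝ} {L q α d₀ d₁ r : ℝ} {xs x w : E} (hL : 0 < L) (hq0 : 0 < q)
    (hg : Differentiable ℝ g) (hlip : ∀ x y, ‖gradient g x - gradient g y‖ ≤ L * ‖x - y‖)
    (hq : StrongConvexOn Set.univ q g) (hmin : IsMinOn g Set.univ xs) (hα : 0 < α)
    (hd₁ : 0 < d₁) (hr : 0 ≤ r) (hα₁ : α * (d₀ * q) ≤ 1)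
    (hα₂ : α * (2 * L * d₁ ^ 2) ≤ d₀)
    (hw : ‖w‖ ≤ d₁ * (‖gradient g x‖ + r))
    (hgw : d₀ * ‖gradient g x‖ ^ 2 - d₁ * ‖gradient g x‖ * r ≤ ⟪gradient g x, w⟫) :
    Real.sqrt (g (x - α • w) - g xs) ≤ (1 - α * (d₀ * q / 2)) * Real.sqrt (g x - g xs)
      + α * ((L * Real.sqrt (2 / q) + L + 1) * d₁) * r := by
  set a := Real.sqrt (g x - g xs) with ha
  set γ := ‖gradient g x‖ with hγ
  set k := L * Real.sqrt (2 / q) with hk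
  have hk0 : 0 ≤ k := by positivity
  have ha0 : 0 ≤ a := Real.sqrt_nonneg _
  have hγ0 : 0 ≤ γ := norm_nonneg _
  have hasq : a ^ 2 = g x - g xs :=
    Real.sq_sqrt (sub_nonneg.2 (hmin (Set.mem_univ x)))
  have hγa : γ ≤ k * a := norm_gradient_le_sqrt_gap hL.le hq0 hg hlip hq hmin x
  have hpl : 2 * q * a ^ 2 ≤ γ ^ 2 := by
    rw [hasq]; exact sub_le_sq_norm_gradient hq0 hg hq x xs
  have hd₀ : 0 < d₀ := lt_of_lt_of_le (by positivity) hα₂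
  have h1 := le_quadratic_of_lipschitz_gradient hg hlip x (x - α • w)
  rw [sub_sub_cancel_left, inner_neg_right, inner_smul_right, norm_neg, norm_smul,
    Real.norm_of_nonneg hα.le] at h1
  have h2 : (α * ‖w‖) ^ 2 ≤ α ^ 2 * d₁ ^ 2 * (2 * γ ^ 2 + 2 * r ^ 2) := by
    have h3 : ‖w‖ ^ 2 ≤ (d₁ * (γ + r)) ^ 2 := pow_le_pow_left₀ (norm_nonneg _) hw 2
    have h4 : (γ + r) ^ 2 ≤ 2 * γ ^ 2 + 2 * r ^ 2 := by nlinarith [sq_nonneg (γ - r)]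
    calc (α * ‖w‖) ^ 2 = α ^ 2 * ‖w‖ ^ 2 := mul_pow _ _ _
      _ ≤ α ^ 2 * (d₁ * (γ + r)) ^ 2 := by gcongr
      _ = α ^ 2 * d₁ ^ 2 * (γ + r) ^ 2 := by ring
      _ ≤ _ := by gcongr
  have h5 : α * (d₀ * γ ^ 2 - d₁ * γ * r) ≤ α * ⟪gradient g x, w⟫ :=
    mul_le_mul_of_nonneg_left hgw hα.le
  have h6 : L / 2 * (α * ‖w‖) ^ 2 ≤ α ^ 2 * L * d₁ ^ 2 * γ ^ 2 + α ^ 2 * L * d₁ ^ 2 * r ^ 2 := by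
    have := mul_le_mul_of_nonneg_left h2 (by positivity : 0 ≤ L / 2)
    linarith
  -- The bound `hα₂` on the step-size lets the curvature term consume at most half of the decrease
  -- `α d₀ γ²`.
  have h7 : α ^ 2 * L * d₁ ^ 2 * γ ^ 2 ≤ α * d₀ / 2 * γ ^ 2 := by
    have := mul_le_mul_of_nonneg_right hα₂ (by positivity : 0 ≤ α * γ ^ 2 / 2)
    linarith
  have h8 : α * d₀ / 2 * (2 * q * a ^ 2) ≤ α * d₀ / 2 * γ ^ 2 :=
    mul_le_mul_of_nonneg_left hpl (by positivity)
  have h9 : α * d₁ * r * γ ≤ α * d₁ * r * (k * a) := mul_le_mul_of_nonneg_left hγa (by positivity)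
  have h10 : g (x - α • w) - g xs ≤ a ^ 2 - α * d₀ * q * a ^ 2 + α * d₁ * r * (k * a)
      + α ^ 2 * L * d₁ ^ 2 * r ^ 2 := by linarith
  have hαc : α * (d₀ * q / 2) ≤ 1 / 2 := by linarith
  refine Real.sqrt_le_iff.2 ⟨add_nonneg (mul_nonneg (by linarith) ha0) (by positivity), ?_⟩
  refine le_trans ?_ (descent_le_sq hα hL hd₁ hk0 ha0 hr hαc)
  linarith

/-- The effect of the variation of the cost on the square root of the optimality gap. -/
theorem sqrt_gap_drift {g g' : E → ℝ} {L q η ζ : ℝ} {xs xs' : E} (hL : 0 < L) (hq0 : 0 < q)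
    (hη0 : 0 ≤ η) (hζ0 : 0 ≤ ζ)
    (hg : Differentiable ℝ g) (hq : StrongConvexOn Set.univ q g) (hmin : IsMinOn g Set.univ xs)
    (hg' : Differentiable ℝ g')
    (hlip' : ∀ x y, ‖gradient g' x - gradient g' y‖ ≤ L * ‖x - y‖)
    (hmin' : IsMinOn g' Set.univ xs') (hη : ∀ x, ‖gradient g' x - gradient g x‖ ≤ η)
    (hζ : ‖xs' - xs‖ ≤ ζ) (x : E) :
    Real.sqrt (g' x - g' xs') ≤
      Real.sqrt (g x - g xs) + (Real.sqrt (2 / q) + L + 1) * (η + ζ) := by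
  have h1 := gap_drift (xs := xs) hg hg' hlip' hmin' hη x
  have h2 := norm_sub_minimizer_le_sqrt_gap hq0 hg hq hmin x
  set a := Real.sqrt (g x - g xs) with ha
  have ha0 : 0 ≤ a := Real.sqrt_nonneg _
  have hasq : a ^ 2 = g x - g xs :=
    Real.sq_sqrt (sub_nonneg.2 (hmin (Set.mem_univ x)))
  set k := Real.sqrt (2 / q)
  have hk : 0 ≤ k := Real.sqrt_nonneg _
  refine Real.sqrt_le_iff.2 ⟨by positivity, ?_⟩
  have h3 : η * ‖x - xs‖ ≤ η * (k * a) := mul_le_mul_of_nonneg_left h2 hη0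
  have h4 : ‖xs' - xs‖ ^ 2 ≤ ζ ^ 2 := pow_le_pow_left₀ (norm_nonneg _) hζ 2
  have h5 : L / 2 * ‖xs' - xs‖ ^ 2 ≤ L / 2 * ζ ^ 2 := mul_le_mul_of_nonneg_left h4 (by positivity)
  -- A drift of the gap of order `η a + ζ²` is a drift of its root of order `η + ζ`: the first term
  -- goes into the double product, the second into the square.
  have h6 : η * (k * a) ≤ 2 * a * ((k + L + 1) * (η + ζ)) := by
    have : 0 ≤ a * (η * k + 2 * (η * (L + 1)) + 2 * (ζ * (k + L + 1))) := by positivity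
    linarith
  have h7 : L / 2 * ζ ^ 2 ≤ ((k + L + 1) * (η + ζ)) ^ 2 := by
    have i1 : L / 2 ≤ (k + L + 1) ^ 2 := by nlinarith
    calc L / 2 * ζ ^ 2 ≤ (k + L + 1) ^ 2 * (η + ζ) ^ 2 := by gcongr; linarith
      _ = _ := by ring
  linarith

end Descent

end GTAdam

end

noncomputable section

namespace GTAdam

open scoped RealInnerProductSpace

/-! ### Componentwise scaling -/

section Scale

variable {n : ℕ}

/-- Componentwise multiplication of a vector by the coefficients `c`. -/
def scale (c : Fin n → ℝ) (u : Vec n) : Vec n := WithLp.toLp 2 fun k => u k * c k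

theorem norm_scale_le {c : Fin n → ℝ} {d₁ : ℝ} (hd₁ : 0 ≤ d₁) (hc0 : ∀ k, 0 ≤ c k)
    (hc : ∀ k, c k ≤ d₁) (u : Vec n) : ‖scale c u‖ ≤ d₁ * ‖u‖ := by
  refine abs_le_of_sq_le_sq' ?_ (by positivity) |>.2
  rw [mul_pow, EuclideanSpace.norm_sq_eq, EuclideanSpace.norm_sq_eq, Finset.mul_sum]
  refine Finset.sum_le_sum fun k _ => ?_
  simp only [scale, Real.norm_eq_abs, sq_abs, mul_pow]
  rw [mul_comm]
  exact mul_le_mul_of_nonneg_right (pow_le_pow_left₀ (hc0 k) (hc k) 2) (sq_nonneg _)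

/-- Split `u = g + (u - g)`: on `g` the scaling is a diagonal form bounded below by `d₀`, and the
remainder costs Cauchy–Schwarz. -/
theorem le_inner_scale {c : Fin n → ℝ} {d₀ d₁ : ℝ} (hd₀ : 0 ≤ d₀) (hd₁ : 0 ≤ d₁)
    (hc0 : ∀ k, d₀ ≤ c k) (hc : ∀ k, c k ≤ d₁) (g u : Vec n) :
    d₀ * ‖g‖ ^ 2 - d₁ * ‖g‖ * ‖u - g‖ ≤ ⟪g, scale c u⟫ := by
  have h1 : scale c u = scale c g + scale c (u - g) := by
    ext k; simp [scale]; ring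
  have h2 : d₀ * ‖g‖ ^ 2 ≤ ⟪g, scale c g⟫ := by
    rw [EuclideanSpace.norm_sq_eq, Finset.mul_sum, PiLp.inner_apply]
    refine Finset.sum_le_sum fun k _ => ?_
    have := mul_le_mul_of_nonneg_right (hc0 k) (mul_self_nonneg (g k))
    simp only [scale, Real.norm_eq_abs, sq_abs, RCLike.inner_apply, conj_trivial]
    nlinarith
  have h3 := neg_le_of_abs_le (abs_real_inner_le_norm g (scale c (u - g)))
  have h4 := mul_le_mul_of_nonneg_left
    (norm_scale_le hd₁ (fun k => hd₀.trans (hc0 k)) hc (u - g)) (norm_nonneg g)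
  rw [h1, inner_add_right]
  linarith

/-- The agents have different preconditioners, so the average direction is not a scaling of an
average vector; a lower bound against the common gradient still passes to the average. -/
theorem le_inner_avg {N : ℕ} (hN : 0 < N) {u : Fin N → Vec n} {g : Vec n} {c : ℝ}
    (h : ∀ i, c ≤ ⟪g, u i⟫) : c ≤ ⟪g, avg u⟫ := by
  have hN' : (0 : ℝ) < N := by positivity
  rw [avg, inner_smul_right, inner_sum, one_div, le_inv_mul_iff₀ hN']
  refine le_trans ?_ (Finset.sum_le_sum fun i _ => h i)
  simp

end Scale

/-! ### Invariants of the iteration -/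

section Invariants

variable {N n : ℕ} {W : Matrix (Fin N) (Fin N) ℝ} {p : Params} {f : Fin N → ℕ → Vec n → ℝ}
  {x₀ : Fin N → Vec n}

/-- This range is all that is used of the second momentum, which is why no constant depends on `β₂`.
-/
theorem nextV_mem (hβ₂ : 0 < p.β₂) (hβ₂' : p.β₂ < 1) (hG : 0 < p.G) {z : State N n}
    (hv : ∀ i k, 0 ≤ z.v i k) (i : Fin N) (k : Fin n) :
    0 ≤ nextV p z i k ∧ nextV p z i k ≤ p.G :=
  ⟨le_min (add_nonneg (mul_nonneg hβ₂.le (hv i k))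
    (mul_nonneg (by linarith) (mul_self_nonneg _))) hG.le, min_le_right _ _⟩

theorem iterate_v_nonneg (hβ₂ : 0 < p.β₂) (hβ₂' : p.β₂ < 1) (hG : 0 < p.G) (t : ℕ) :
    ∀ i k, 0 ≤ (iterate W p f x₀ t).v i k := by
  induction t with
  | zero => intro i k; simp [iterate]
  | succ t ih => exact fun i k => (nextV_mem hβ₂ hβ₂' hG ih i k).1

theorem step_s (t : ℕ) (z : State N n) :
    (step W p f t z).s =
      fun i => mix W z.s i + (gradient (f i (t + 1)) (nextX W p z i) - gradient (f i t) (z.x i)) := by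
  ext1 i
  simp only [step, mix_apply]
  abel

theorem nextX_eq (z : State N n) :
    nextX W p z = fun i => mix W z.x i - p.α • direction p z i := rfl

theorem avg_nextX (hcol : ∀ j, ∑ i, W i j = 1) (z : State N n) :
    avg (nextX W p z) = avg z.x - p.α • avg (direction p z) := by
  rw [nextX_eq, avg_sub, avg_mix hcol, avg_smul]

theorem avg_nextM (z : State N n) :
    avg (nextM p z) = p.β₁ • avg z.m + (1 - p.β₁) • avg z.s := by
  have : nextM p z = fun i => p.β₁ • z.m i + (1 - p.β₁) • z.s i := rfl
  rw [this, avg_add, avg_smul, avg_smul]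

/-- The average tracker is the average of the local gradients. -/
theorem avg_iterate_s (hcol : ∀ j, ∑ i, W i j = 1) (t : ℕ) :
    avg (iterate W p f x₀ t).s = avg fun i => gradient (f i t) ((iterate W p f x₀ t).x i) := by
  induction t with
  | zero => rfl
  | succ t ih =>
    have h : (iterate W p f x₀ (t + 1)).x = nextX W p (iterate W p f x₀ t) := rfl
    -- Averaging preserves the mean and the gradient increments telescope.
    rw [h, iterate, step_s, avg_add, avg_sub, avg_mix hcol, ih]
    abel

theorem direction_eq_scale (z : State N n) (i : Fin N) :
    direction p z i = scale (fun k => 1 / Real.sqrt (nextV p z i k + p.ε)) (nextM p z i) := by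
  ext k
  simp [direction, scale, div_eq_mul_inv]

end Invariants

/-! ### One iteration -/

section OneStep

variable {N n : ℕ} {W : Matrix (Fin N) (Fin N) ℝ} {p : Params} {f : Fin N → ℕ → Vec n → ℝ}
  {P : Seminorm ℝ (Fin N → Vec n)} {L τ C η : ℝ} {t : ℕ} {z : State N n}

/-- The error made when the momenta are used in place of the gradient of the network cost. -/
def momentumError (P : Seminorm ℝ (Fin N → Vec n)) (L : ℝ) (z : State N n) : ℝ :=
  L * P z.x + ‖avg z.s - avg z.m‖ + P z.m + P z.s

theorem momentumError_nonneg (hL : 0 ≤ L) : 0 ≤ momentumError P L z := by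
  unfold momentumError
  have := apply_nonneg P z.x
  have := apply_nonneg P z.m
  have := apply_nonneg P z.s
  positivity

/-- The two differ only because the agents evaluate their gradients at their own estimates. -/
theorem norm_avg_s_sub_gradient_le (hN : 0 < N) (hdev : ∀ u i, ‖u i - avg u‖ ≤ P u)
    (hL : 0 ≤ L) (hf : ∀ i, LipschitzGradient L (f i t))
    (htrack : avg z.s = avg fun i => gradient (f i t) (z.x i)) :
    ‖avg z.s - gradient (cost f t) (avg z.x)‖ ≤ L * P z.x := by
  rw [htrack, gradient_cost fun i => (hf i).1, ← avg_sub]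
  exact norm_avg_le hN fun i => ((hf i).2 _ _).trans (mul_le_mul_of_nonneg_left (hdev _ i) hL)

theorem norm_nextM_sub_gradient_le (hN : 0 < N) (hdev : ∀ u i, ‖u i - avg u‖ ≤ P u)
    (hβ₁ : 0 < p.β₁) (hβ₁' : p.β₁ < 1) (hL : 0 ≤ L)
    (hf : ∀ i, LipschitzGradient L (f i t))
    (htrack : avg z.s = avg fun i => gradient (f i t) (z.x i)) (i : Fin N) :
    ‖nextM p z i - gradient (cost f t) (avg z.x)‖ ≤ momentumError P L z := by
  set g := gradient (cost f t) (avg z.x)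
  have h0 := norm_avg_s_sub_gradient_le hN hdev hL hf htrack
  have h1 : nextM p z i - g = (avg z.s - g) - p.β₁ • (avg z.s - avg z.m)
      + p.β₁ • (z.m i - avg z.m) + (1 - p.β₁) • (z.s i - avg z.s) := by
    simp only [nextM]
    module
  have hc : ∀ {c : ℝ} (_ : 0 ≤ c) (_ : c ≤ 1) (u : Vec n), ‖c • u‖ ≤ ‖u‖ := fun hc hc' u => by
    rw [norm_smul, Real.norm_of_nonneg hc]
    exact mul_le_of_le_one_left (norm_nonneg u) hc'
  have h2 := hc hβ₁.le hβ₁'.le (avg z.s - avg z.m)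
  have h3 := hc hβ₁.le hβ₁'.le (z.m i - avg z.m)
  have h4 := hc (sub_nonneg.2 hβ₁'.le) (by linarith) (z.s i - avg z.s)
  have h5 := hdev z.m i
  have h6 := hdev z.s i
  rw [h1, momentumError]
  refine (norm_add_le _ _).trans ?_
  refine (add_le_add_left ((norm_add_le _ _).trans (add_le_add_left (norm_sub_le _ _) _)) _).trans ?_
  linarith

theorem scale_coeff_bounds (hε : 0 < p.ε) (hv : ∀ i k, 0 ≤ nextV p z i k ∧ nextV p z i k ≤ p.G)
    (i : Fin N) (k : Fin n) :
    1 / Real.sqrt (p.G + p.ε) ≤ 1 / Real.sqrt (nextV p z i k + p.ε) ∧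
      1 / Real.sqrt (nextV p z i k + p.ε) ≤ 1 / Real.sqrt p.ε := by
  obtain ⟨h0, h1⟩ := hv i k
  exact ⟨one_div_le_one_div_of_le (Real.sqrt_pos.2 (by linarith)) (Real.sqrt_le_sqrt (by linarith)),
    one_div_le_one_div_of_le (Real.sqrt_pos.2 hε) (Real.sqrt_le_sqrt (by linarith))⟩

/-- A bound for all the update directions. -/
def directionBound (P : Seminorm ℝ (Fin N → Vec n)) (L : ℝ) (p : Params)
    (f : Fin N → ℕ → Vec n → ℝ) (t : ℕ) (z : State N n) : ℝ :=
  1 / Real.sqrt p.ε * (‖gradient (cost f t) (avg z.x)‖ + momentumError P L z)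

theorem norm_direction_le (hN : 0 < N) (hdev : ∀ u i, ‖u i - avg u‖ ≤ P u)
    (hβ₁ : 0 < p.β₁) (hβ₁' : p.β₁ < 1) (hL : 0 ≤ L) (hε : 0 < p.ε)
    (hv : ∀ i k, 0 ≤ nextV p z i k ∧ nextV p z i k ≤ p.G)
    (hf : ∀ i, LipschitzGradient L (f i t))
    (htrack : avg z.s = avg fun i => gradient (f i t) (z.x i)) (i : Fin N) :
    ‖direction p z i‖ ≤ directionBound P L p f t z := by
  rw [direction_eq_scale, directionBound]
  refine (norm_scale_le (by positivity) (fun k => by positivity)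
    (fun k => (scale_coeff_bounds hε hv i k).2) _).trans ?_
  refine mul_le_mul_of_nonneg_left ?_ (by positivity)
  have h1 := norm_nextM_sub_gradient_le hN hdev hβ₁ hβ₁' hL hf htrack i
  have h2 := norm_sub_norm_le (nextM p z i) (gradient (cost f t) (avg z.x))
  linarith

theorem le_inner_avg_direction (hN : 0 < N) (hdev : ∀ u i, ‖u i - avg u‖ ≤ P u)
    (hβ₁ : 0 < p.β₁) (hβ₁' : p.β₁ < 1) (hL : 0 ≤ L) (hε : 0 < p.ε)
    (hv : ∀ i k, 0 ≤ nextV p z i k ∧ nextV p z i k ≤ p.G)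
    (hf : ∀ i, LipschitzGradient L (f i t))
    (htrack : avg z.s = avg fun i => gradient (f i t) (z.x i)) :
    1 / Real.sqrt (p.G + p.ε) * ‖gradient (cost f t) (avg z.x)‖ ^ 2
        - 1 / Real.sqrt p.ε * ‖gradient (cost f t) (avg z.x)‖ * momentumError P L z ≤
      ⟪gradient (cost f t) (avg z.x), avg (direction p z)⟫ := by
  refine le_inner_avg hN fun i => ?_
  rw [direction_eq_scale]
  refine le_trans ?_ (le_inner_scale (by positivity) (by positivity)
    (fun k => (scale_coeff_bounds hε hv i k).1) (fun k => (scale_coeff_bounds hε hv i k).2) _ _)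
  have := mul_le_mul_of_nonneg_left (norm_nextM_sub_gradient_le hN hdev hβ₁ hβ₁' hL hf htrack i)
    (by positivity : 0 ≤ 1 / Real.sqrt p.ε * ‖gradient (cost f t) (avg z.x)‖)
  linarith

theorem seminorm_nextM_le (hβ₁ : 0 < p.β₁) (hβ₁' : p.β₁ < 1) :
    P (nextM p z) ≤ p.β₁ * P z.m + (1 - p.β₁) * P z.s := by
  have h : nextM p z = p.β₁ • z.m + (1 - p.β₁) • z.s := rfl
  rw [h]
  refine (map_add_le_add P _ _).trans ?_
  rw [map_smul_eq_mul, map_smul_eq_mul, Real.norm_of_nonneg hβ₁.le,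
    Real.norm_of_nonneg (by linarith)]

theorem seminorm_le_of_forall_norm_le (hC : 0 ≤ C) (hPC : ∀ u, P u ≤ C * ‖u‖) {u : Fin N → Vec n}
    {B : ℝ} (hB : 0 ≤ B) (h : ∀ i, ‖u i‖ ≤ B) : P u ≤ C * B :=
  (hPC u).trans (mul_le_mul_of_nonneg_left ((pi_norm_le_iff_of_nonneg hB).2 h) hC)

theorem seminorm_nextX_le (hα : 0 ≤ p.α) (hC : 0 ≤ C) (hPC : ∀ u, P u ≤ C * ‖u‖)
    (hmix : ∀ u, P (mix W u) ≤ τ * P u) {ω : ℝ} (hω : 0 ≤ ω) (hdir : ∀ i, ‖direction p z i‖ ≤ ω) :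
    P (nextX W p z) ≤ τ * P z.x + p.α * (C * ω) := by
  have h : nextX W p z = mix W z.x - p.α • direction p z := rfl
  have h1 := map_sub_le_add P (mix W z.x) (p.α • direction p z)
  rw [map_smul_eq_mul, Real.norm_of_nonneg hα, ← h] at h1
  have h2 := mul_le_mul_of_nonneg_left (seminorm_le_of_forall_norm_le hC hPC hω hdir) hα
  linarith [hmix z.x]

/-- Averaging moves an agent only through disagreement, so the optimality gap enters the
displacement only with the factor `α`. -/
theorem norm_nextX_sub_le (hdev : ∀ u i, ‖u i - avg u‖ ≤ P u)
    (hsums : RowColSumsOne W) (hα : 0 ≤ p.α) (hτ : τ ≤ 1)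
    (hmix : ∀ u, P (mix W u) ≤ τ * P u) {ω : ℝ} (hdir : ∀ i, ‖direction p z i‖ ≤ ω) (i : Fin N) :
    ‖nextX W p z i - z.x i‖ ≤ 2 * P z.x + p.α * ω := by
  have h1 : nextX W p z i - z.x i =
      (mix W z.x i - avg (mix W z.x)) - (z.x i - avg z.x) - p.α • direction p z i := by
    rw [avg_mix hsums.1, nextX_eq]; module
  have h2 := hdev (mix W z.x) i
  have h3 := hdev z.x i
  have h4 := mul_le_mul_of_nonneg_left (hdir i) hα
  have h5 := hmix z.x
  have h6 := mul_le_of_le_one_left (apply_nonneg P z.x) hτ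
  rw [h1]
  refine (norm_sub_le _ _).trans ((add_le_add_left (norm_sub_le _ _) _).trans ?_)
  rw [norm_smul, Real.norm_of_nonneg hα]
  linarith

theorem norm_gradient_change_le (hdev : ∀ u i, ‖u i - avg u‖ ≤ P u)
    (hsums : RowColSumsOne W) (hα : 0 ≤ p.α) (hL : 0 ≤ L) (hτ : τ ≤ 1)
    (hmix : ∀ u, P (mix W u) ≤ τ * P u) {ω : ℝ} (hdir : ∀ i, ‖direction p z i‖ ≤ ω)
    (hf : ∀ i, LipschitzGradient L (f i t))
    (hη : ∀ i x, ‖gradient (f i (t + 1)) x - gradient (f i t) x‖ ≤ η) (i : Fin N) :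
    ‖gradient (f i (t + 1)) (nextX W p z i) - gradient (f i t) (z.x i)‖ ≤
      η + L * (2 * P z.x + p.α * ω) := by
  have h1 := mul_le_mul_of_nonneg_left (norm_nextX_sub_le hdev hsums hα hτ hmix hdir i) hL
  have h2 := (hf i).2 (nextX W p z i) (z.x i)
  have h3 := hη i (nextX W p z i)
  have h4 := norm_sub_le_norm_sub_add_norm_sub (gradient (f i (t + 1)) (nextX W p z i))
    (gradient (f i t) (nextX W p z i)) (gradient (f i t) (z.x i))
  linarith

theorem seminorm_step_s_le (hC : 0 ≤ C) (hPC : ∀ u, P u ≤ C * ‖u‖)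
    (hmix : ∀ u, P (mix W u) ≤ τ * P u) {B : ℝ} (hB : 0 ≤ B)
    (hchange : ∀ i, ‖gradient (f i (t + 1)) (nextX W p z i) - gradient (f i t) (z.x i)‖ ≤ B) :
    P (step W p f t z).s ≤ τ * P z.s + C * B := by
  rw [step_s]
  exact (map_add_le_add P (mix W z.s) _).trans
    (add_le_add (hmix z.s) (seminorm_le_of_forall_norm_le hC hPC hB hchange))

/-- The average momentum relaxes towards the average tracker, shrinking the lag by `β₁`, while the
tracker itself moves by the mean gradient increment. -/
theorem norm_step_avg_s_sub_avg_m_le (hN : 0 < N)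
    (hsums : RowColSumsOne W) (hβ₁ : 0 < p.β₁) {B : ℝ}
    (hchange : ∀ i, ‖gradient (f i (t + 1)) (nextX W p z i) - gradient (f i t) (z.x i)‖ ≤ B) :
    ‖avg (step W p f t z).s - avg (step W p f t z).m‖ ≤ p.β₁ * ‖avg z.s - avg z.m‖ + B := by
  have hm : (step W p f t z).m = nextM p z := rfl
  rw [step_s, hm, avg_nextM, avg_add, avg_mix hsums.1]
  have h := norm_avg_le hN hchange
  set D := avg fun i => gradient (f i (t + 1)) (nextX W p z i) - gradient (f i t) (z.x i)
  have h1 : avg z.s + D - (p.β₁ • avg z.m + (1 - p.β₁) • avg z.s)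
      = p.β₁ • (avg z.s - avg z.m) + D := by module
  rw [h1]
  refine (norm_add_le _ _).trans ?_
  rw [norm_smul, Real.norm_of_nonneg hβ₁.le]
  linarith

end OneStep

end GTAdam

end

noncomputable section

namespace GTAdam

/-! ### The comparison system -/

section Comparison

/-- The weighted sum of the consensus and momentum errors contracts, up to terms of the order of
the step-size and of the variation of the costs. -/
theorem weighted_error_contraction {α β τ C L kS kX δ ω η M S X b M' S' X' b' : ℝ}
    (hδ : δ ≤ 1 - β) (hδ' : δ ≤ (1 - τ) / 2)
    (hkS : kS * (1 - τ) = 2) (hkX : kX * (1 - τ) = 4 * L * (kS * C + 1)) (hβ : 0 ≤ β)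
    (hkS0 : 0 ≤ kS) (hkX0 : 0 ≤ kX) (hM : 0 ≤ M) (hS : 0 ≤ S) (hX : 0 ≤ X) (hb : 0 ≤ b)
    (hM' : M' ≤ β * M + (1 - β) * S) (hX' : X' ≤ τ * X + α * (C * ω))
    (hS' : S' ≤ τ * S + C * (η + L * (2 * X + α * ω)))
    (hb' : b' ≤ β * b + (η + L * (2 * X + α * ω))) :
    M' + kS * S' + b' + kX * X' ≤ (1 - δ) * (M + kS * S + b + kX * X)
      + α * ((kX * C + (kS * C + 1) * L) * ω) + (kS * C + 1) * η := by
  have h1 := mul_le_mul_of_nonneg_left hS' hkS0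
  have h2 := mul_le_mul_of_nonneg_left hX' hkX0
  have h3 := mul_le_mul_of_nonneg_right hδ hM
  have h4 := mul_le_mul_of_nonneg_right hδ hb
  have h5 := mul_le_mul_of_nonneg_right hδ' (mul_nonneg hkS0 hS)
  have h6 := mul_le_mul_of_nonneg_right hδ' (mul_nonneg hkX0 hX)
  -- The coupling is triangular: `X` feeds `S` and `b`, and `S` feeds `M`. Each weight is chosen so
  -- that half of the contraction pays for what the quantity feeds and half leaves the rate `δ`.
  have h7 : kS * S - τ * (kS * S) = 2 * S := by rw [← hkS]; ring
  have h8 : kX * X - τ * (kX * X) = 4 * L * (kS * C + 1) * X := by rw [← hkX]; ring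
  have h9 := mul_nonneg hβ hS
  linarith

theorem le_geometric_of_le {U : ℕ → ℝ} {κ e : ℝ} (hκ : 0 < κ) (hκ1 : κ ≤ 1) (he : 0 ≤ e)
    (h : ∀ t, U (t + 1) ≤ (1 - κ) * U t + e) (t : ℕ) :
    U t ≤ (1 - κ) ^ t * U 0 + e / κ := by
  induction t with
  | zero => simpa using by positivity
  | succ t ih =>
    have h1 := mul_le_mul_of_nonneg_left ih (sub_nonneg.2 hκ1)
    have h2 : (1 - κ) * (e / κ) + e = e / κ := by field_simp; ring
    calc U (t + 1) ≤ (1 - κ) * U t + e := h t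
      _ ≤ (1 - κ) * ((1 - κ) ^ t * U 0 + e / κ) + e := by linarith
      _ = (1 - κ) ^ (t + 1) * U 0 + ((1 - κ) * (e / κ) + e) := by ring
      _ = _ := by rw [h2]

/-- A slow quantity `a` coupled with a fast quantity `F` through a small step-size. -/
theorem coupled_system_bound {a F : ℕ → ℝ} {α c δ A B k D K e : ℝ} (hα : 0 < α) (hc : 0 < c)
    (hK : 0 < K) (hD : 0 ≤ D) (he : 0 ≤ e) (ha : ∀ t, 0 ≤ a t) (hF : ∀ t, 0 ≤ F t)
    (hαc : α * c ≤ 2) (hKc : K * (B * k) ≤ c / 2) (hαK : α * (A + K * B + K * (c / 2)) ≤ K * δ)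
    (hFrec : ∀ t, F (t + 1) ≤ (1 - δ) * F t + α * (B * (k * a t + F t)) + D * e)
    (harec : ∀ t, a (t + 1) ≤ (1 - α * c) * a t + α * A * F t + D * e) (t : ℕ) :
    a t ≤ (1 - α * c / 2) ^ t * (a 0 + K * F 0) + (1 + K) * D * e / (α * c / 2) := by
  -- In `a + K F`, `hKc` makes the feedback of `a` through `F` cost at most half of the rate `αc`;
  -- `hαK` lets the contraction `δ` of `F` pay for its effect on `a`, its own feedback and the rate
  -- `αc/2`.
  have h := le_geometric_of_le (U := fun t => a t + K * F t) (κ := α * c / 2)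
    (e := (1 + K) * D * e) (by positivity) (by linarith) (by positivity) (fun t => by
      have h1 := mul_le_mul_of_nonneg_left (hFrec t) hK.le
      have h2 := harec t
      have h3 := mul_le_mul_of_nonneg_right hKc (mul_nonneg hα.le (ha t))
      have h4 := mul_le_mul_of_nonneg_right hαK (hF t)
      linarith) t
  exact (le_add_of_nonneg_right (mul_nonneg hK.le (hF t))).trans h

end Comparison

/-! ### Recursions for the iterates -/

section Recursion

variable {N n : ℕ} {W : Matrix (Fin N) (Fin N) ℝ} {p : Params} {f : Fin N → ℕ → Vec n → ℝ}
  {P : Seminorm ℝ (Fin N → Vec n)} {L q τ C η ζ kS kX δ : ℝ} {t : ℕ} {z : State N n}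
  {xs : ℕ → Vec n}

/-- The weighted sum of the consensus and momentum errors. -/
def fastError (P : Seminorm ℝ (Fin N → Vec n)) (kS kX : ℝ) (z : State N n) : ℝ :=
  P z.m + kS * P z.s + ‖avg z.s - avg z.m‖ + kX * P z.x

theorem fastError_nonneg (hkS : 0 ≤ kS) (hkX : 0 ≤ kX) : 0 ≤ fastError P kS kX z := by
  have := apply_nonneg P z.x
  have := apply_nonneg P z.m
  have := apply_nonneg P z.s
  unfold fastError
  positivity

theorem momentumError_le_fastError (hkS : 1 ≤ kS) (hkX : L ≤ kX) :
    momentumError P L z ≤ fastError P kS kX z := by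
  have h1 := mul_le_mul_of_nonneg_right hkX (apply_nonneg P z.x)
  have h2 := mul_le_mul_of_nonneg_right hkS (apply_nonneg P z.s)
  unfold momentumError fastError
  linarith

/-- The square root of the optimality gap of the average estimate. -/
def rootGap (f : Fin N → ℕ → Vec n → ℝ) (xs : ℕ → Vec n) (t : ℕ) (z : State N n) : ℝ :=
  Real.sqrt (cost f t (avg z.x) - cost f t (xs t))

theorem directionBound_le (hN : 0 < N) (hL : 0 < L) (hq : 0 < q) (hkS : 1 ≤ kS) (hkX : L ≤ kX)
    (hf : ∀ i, LipschitzGradient L (f i t)) (hconv : ∀ i, StrongConvexOn Set.univ q (f i t))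
    (hmin : IsMinOn (cost f t) Set.univ (xs t)) :
    directionBound P L p f t z ≤ 1 / Real.sqrt p.ε *
      (L * Real.sqrt (2 / q) * rootGap f xs t z + fastError P kS kX z) := by
  have hc := LipschitzGradient.cost hN hf
  exact mul_le_mul_of_nonneg_left (add_le_add
    (norm_gradient_le_sqrt_gap hL.le hq hc.1 hc.2 (strongConvexOn_cost hN hconv) hmin _)
    (momentumError_le_fastError hkS hkX)) (by positivity)

theorem fastError_step_le (hN : 0 < N) (hsums : RowColSumsOne W)
    (hdev : ∀ u i, ‖u i - avg u‖ ≤ P u) (hmix : ∀ u, P (mix W u) ≤ τ * P u)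
    (hPC : ∀ u, P u ≤ C * ‖u‖) (hC : 0 ≤ C) (hτ : τ < 1) (hL : 0 < L) (hq : 0 < q)
    (hα : 0 < p.α) (hβ₁ : 0 < p.β₁) (hβ₁' : p.β₁ < 1) (hε : 0 < p.ε)
    (hkS : kS * (1 - τ) = 2) (hkX : kX * (1 - τ) = 4 * L * (kS * C + 1))
    (hkS1 : 1 ≤ kS) (hkXL : L ≤ kX) (hδ : δ ≤ 1 - p.β₁) (hδ' : δ ≤ (1 - τ) / 2)
    (hv : ∀ i k, 0 ≤ nextV p z i k ∧ nextV p z i k ≤ p.G)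
    (hf : ∀ i, LipschitzGradient L (f i t)) (hconv : ∀ i, StrongConvexOn Set.univ q (f i t))
    (hmin : IsMinOn (cost f t) Set.univ (xs t))
    (htrack : avg z.s = avg fun i => gradient (f i t) (z.x i))
    (hη : ∀ i x, ‖gradient (f i (t + 1)) x - gradient (f i t) x‖ ≤ η) :
    fastError P kS kX (step W p f t z) ≤ (1 - δ) * fastError P kS kX z
      + p.α * ((kX * C + (kS * C + 1) * L) * (1 / Real.sqrt p.ε) *
        (L * Real.sqrt (2 / q) * rootGap f xs t z + fastError P kS kX z))
      + (kS * C + 1) * η := by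
  have hdir := norm_direction_le hN hdev hβ₁ hβ₁' hL.le hε hv hf htrack
  have hω : 0 ≤ directionBound P L p f t z := (norm_nonneg _).trans (hdir ⟨0, hN⟩)
  have hchange := norm_gradient_change_le hdev hsums hα.le hL.le hτ.le hmix hdir hf hη
  have hB := (norm_nonneg _).trans (hchange ⟨0, hN⟩)
  have h1 := weighted_error_contraction hδ hδ' hkS hkX hβ₁.le (by linarith) (by linarith)
    (apply_nonneg P z.m) (apply_nonneg P z.s) (apply_nonneg P z.x) (norm_nonneg _)
    (seminorm_nextM_le hβ₁ hβ₁') (seminorm_nextX_le hα.le hC hPC hmix hω hdir)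
    (seminorm_step_s_le hC hPC hmix hB hchange)
    (norm_step_avg_s_sub_avg_m_le hN hsums hβ₁ hchange)
  refine h1.trans ?_
  have hkX0 : 0 ≤ kX := by linarith
  have hkS0 : 0 ≤ kS := by linarith
  have h2 := directionBound_le (P := P) (z := z) (p := p) hN hL hq hkS1 hkXL hf hconv hmin
  have h3 : p.α * ((kX * C + (kS * C + 1) * L) * directionBound P L p f t z) ≤
      p.α * ((kX * C + (kS * C + 1) * L) * (1 / Real.sqrt p.ε *
      (L * Real.sqrt (2 / q) * rootGap f xs t z + fastError P kS kX z))) := by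
    gcongr
  rw [mul_assoc (kX * C + (kS * C + 1) * L)]
  exact add_le_add_left (add_le_add_right h3 _) _

theorem rootGap_step_le (hN : 0 < N) (hsums : RowColSumsOne W)
    (hdev : ∀ u i, ‖u i - avg u‖ ≤ P u) (hL : 0 < L) (hq : 0 < q)
    (hη0 : 0 ≤ η) (hζ0 : 0 ≤ ζ) (hα : 0 < p.α) (hβ₁ : 0 < p.β₁) (hβ₁' : p.β₁ < 1) (hε : 0 < p.ε)
    (hα₁ : p.α * (1 / Real.sqrt (p.G + p.ε) * q) ≤ 1)
    (hα₂ : p.α * (2 * L * (1 / Real.sqrt p.ε) ^ 2) ≤ 1 / Real.sqrt (p.G + p.ε))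
    (hkS1 : 1 ≤ kS) (hkXL : L ≤ kX)
    (hv : ∀ i k, 0 ≤ nextV p z i k ∧ nextV p z i k ≤ p.G)
    (hf : ∀ i t, LipschitzGradient L (f i t)) (hconv : ∀ i t, StrongConvexOn Set.univ q (f i t))
    (hmin : ∀ t, IsMinOn (cost f t) Set.univ (xs t))
    (htrack : avg z.s = avg fun i => gradient (f i t) (z.x i))
    (hη : ∀ i x, ‖gradient (f i (t + 1)) x - gradient (f i t) x‖ ≤ η)
    (hζ : ‖xs (t + 1) - xs t‖ ≤ ζ) :
    rootGap f xs (t + 1) (step W p f t z) ≤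
      (1 - p.α * (1 / Real.sqrt (p.G + p.ε) * q / 2)) * rootGap f xs t z
      + p.α * ((L * Real.sqrt (2 / q) + L + 1) * (1 / Real.sqrt p.ε)) * fastError P kS kX z
      + (Real.sqrt (2 / q) + L + 1) * (η + ζ) := by
  have hc := fun t => LipschitzGradient.cost hN fun i => hf i t
  have hs := fun t => strongConvexOn_cost hN fun i => hconv i t
  have h1 := sqrt_gap_descent (x := avg z.x) hL hq (hc t).1 (hc t).2 (hs t) (hmin t) hα (by positivity)
    (momentumError_nonneg hL.le) hα₁ hα₂
    (norm_avg_le hN (norm_direction_le hN hdev hβ₁ hβ₁' hL.le hε hv (fun i => hf i t) htrack))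
    (le_inner_avg_direction hN hdev hβ₁ hβ₁' hL.le hε hv (fun i => hf i t) htrack)
  rw [← avg_nextX hsums.1] at h1
  have h2 := sqrt_gap_drift hL hq hη0 hζ0 (hc t).1 (hs t) (hmin t) (hc (t + 1)).1 (hc (t + 1)).2
    (hmin (t + 1)) (fun x => by
      rw [gradient_cost fun i => (hf i (t + 1)).1, gradient_cost fun i => (hf i t).1, ← avg_sub]
      exact norm_avg_le hN fun i => hη i x) hζ (avg (nextX W p z))
  have h3 := mul_le_mul_of_nonneg_left
    (momentumError_le_fastError (P := P) (z := z) hkS1 hkXL)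
    (by positivity : 0 ≤ p.α * ((L * Real.sqrt (2 / q) + L + 1) * (1 / Real.sqrt p.ε)))
  exact h2.trans (add_le_add_left (h1.trans (add_le_add_right h3 _)) _)

end Recursion

/-! ### The initial errors -/

section Initial

variable {N n : ℕ}

theorem sq_norm_errorVec (z : State N n) (y : Vec n) :
    ‖errorVec z y‖ ^ 2 = ‖avg z.m‖ ^ 2 + ‖avg z.s - avg z.m‖ ^ 2 + disagreement z.m ^ 2
      + disagreement z.s ^ 2 + disagreement z.x ^ 2 + ‖avg z.x - y‖ ^ 2 := by
  rw [EuclideanSpace.norm_sq_eq, Fin.sum_univ_six]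
  simp [errorVec, sq_abs]

theorem le_norm_errorVec (z : State N n) (y : Vec n) :
    ‖avg z.s - avg z.m‖ ≤ ‖errorVec z y‖ ∧ disagreement z.s ≤ ‖errorVec z y‖ ∧
      disagreement z.x ≤ ‖errorVec z y‖ := by
  have h := sq_norm_errorVec z y
  have h1 := sq_nonneg ‖avg z.m‖
  have h2 := sq_nonneg ‖avg z.s - avg z.m‖
  have h3 := sq_nonneg (disagreement z.m)
  have h4 := sq_nonneg (disagreement z.s)
  have h5 := sq_nonneg (disagreement z.x)
  have h6 := sq_nonneg ‖avg z.x - y‖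
  refine ⟨?_, ?_, ?_⟩ <;>
    exact (abs_le_of_sq_le_sq' (by linarith) (norm_nonneg _)).2

end Initial

end GTAdam

end

noncomputable section

namespace GTAdam

/-! ### Initial values of the fast and slow errors. -/

section InitialBounds

variable {N n : ℕ} {f : Fin N → ℕ → Vec n → ℝ} {P : Seminorm ℝ (Fin N → Vec n)}
  {L q C kS kX : ℝ} {z : State N n} {xs : ℕ → Vec n}

theorem fastError_initial_le (hkS : 0 ≤ kS) (hkX : 0 ≤ kX) (hC : 0 ≤ C)
    (hPD : ∀ u, P u ≤ C * disagreement u) (hm : z.m = 0) (y : Vec n) :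
    fastError P kS kX z ≤ (kS * C + 1 + kX * C) * ‖errorVec z y‖ := by
  obtain ⟨h1, h2, h3⟩ := le_norm_errorVec z y
  have h4 := mul_le_mul_of_nonneg_left ((hPD z.s).trans (mul_le_mul_of_nonneg_left h2 hC)) hkS
  have h5 := mul_le_mul_of_nonneg_left ((hPD z.x).trans (mul_le_mul_of_nonneg_left h3 hC)) hkX
  have h6 : P z.m = 0 := by rw [hm, map_zero]
  unfold fastError
  linarith

/-- Initially, the distance from the minimizer is a definite fraction of all the errors: it is
witnessed by the trackers and by the disagreement. -/
theorem norm_avg_sub_minimizer_initial_le (hN : 0 < N) (hL : 0 < L) (hq : 0 < q) (hC : 0 ≤ C)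
    (hdev : ∀ u i, ‖u i - avg u‖ ≤ P u) (hPD : ∀ u, P u ≤ C * disagreement u) (hm : z.m = 0)
    (hf : ∀ i, LipschitzGradient L (f i 0)) (hconv : ∀ i, StrongConvexOn Set.univ q (f i 0))
    (hmin : IsMinOn (cost f 0) Set.univ (xs 0))
    (htrack : avg z.s = avg fun i => gradient (f i 0) (z.x i)) :
    Real.sqrt (1 + (q / (1 + L * C)) ^ 2) * ‖avg z.x - xs 0‖ ≤ ‖errorVec z (xs 0)‖ := by
  have hc := LipschitzGradient.cost hN hf
  have h1 := mul_norm_sub_minimizer_le_norm_gradient hq hc.1 (strongConvexOn_cost hN hconv) hmin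
    (avg z.x)
  have h2 := norm_avg_s_sub_gradient_le hN hdev hL.le hf htrack
  have h3 := norm_sub_norm_le (gradient (cost f 0) (avg z.x)) (avg z.s)
  rw [norm_sub_rev] at h3
  have h4 := mul_le_mul_of_nonneg_left (hPD z.x) hL.le
  have h5 := sq_norm_errorVec z (xs 0)
  have hm0 : avg z.m = 0 := by simp [hm, avg]
  rw [hm0, sub_zero] at h5
  set b := ‖avg z.s‖
  set D := disagreement z.x
  set e := ‖avg z.x - xs 0‖
  have hb : 0 ≤ b := norm_nonneg _
  have hD : 0 ≤ D := Real.sqrt_nonneg _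
  have he : 0 ≤ e := norm_nonneg _
  have hLC : 0 ≤ L * C := by positivity
  have h6 : q * e ≤ b + L * C * D := by linarith
  have h7 : (q * e) ^ 2 ≤ (1 + L * C) ^ 2 * (b ^ 2 + D ^ 2) := by
    refine (pow_le_pow_left₀ (by positivity) h6 2).trans ?_
    have i1 : 0 ≤ (L * C) ^ 2 * b ^ 2 + D ^ 2 + L * C * (b - D) ^ 2 + L * C * (b ^ 2 + D ^ 2) := by
      positivity
    linarith
  -- As `m̄₀ = 0`, the numbers `b`, `D` and `e` are three different components of the error vector,
  -- so its square exceeds `e²` by a definite multiple of `e²`.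
  have h8 : (q / (1 + L * C)) ^ 2 * e ^ 2 ≤ b ^ 2 + D ^ 2 := by
    rw [div_pow, div_mul_eq_mul_div, div_le_iff₀ (by positivity)]
    linarith
  refine (abs_le_of_sq_le_sq' ?_ (norm_nonneg _)).2
  rw [mul_pow, Real.sq_sqrt (by positivity), h5]
  have i2 := sq_nonneg ‖(0 : Vec n)‖
  have i3 := sq_nonneg (disagreement z.m)
  have i4 := sq_nonneg (disagreement z.s)
  linarith

theorem rootGap_le (hN : 0 < N) {t : ℕ} (hL : 0 < L) (hf : ∀ i, LipschitzGradient L (f i t))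
    (hmin : IsMinOn (cost f t) Set.univ (xs t)) :
    rootGap f xs t z ≤ Real.sqrt (L / 2) * ‖avg z.x - xs t‖ := by
  have hc := LipschitzGradient.cost hN hf
  have h := le_quadratic_of_lipschitz_gradient hc.1 hc.2 (xs t) (avg z.x)
  rw [gradient_eq_zero_of_isMinOn hmin, inner_zero_left] at h
  refine Real.sqrt_le_iff.2 ⟨by positivity, ?_⟩
  rw [mul_pow, Real.sq_sqrt (by positivity)]
  linarith

end InitialBounds

/-! ### Choice of the constants and conclusion. -/

theorem add_le_two_mul_sqrt {N : ℕ} (hN : 0 < N) {L η ζ : ℝ} :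
    η + ζ ≤ 2 * Real.sqrt (L ^ 2 * η ^ 2 / N + N * η ^ 2 + ζ ^ 2) := by
  have hN' : (1 : ℝ) ≤ N := by exact_mod_cast hN
  have h1 : η ^ 2 ≤ N * η ^ 2 := le_mul_of_one_le_left (sq_nonneg η) hN'
  have h2 : 0 ≤ L ^ 2 * η ^ 2 / N := by positivity
  have h3 : η ≤ Real.sqrt (L ^ 2 * η ^ 2 / N + N * η ^ 2 + ζ ^ 2) :=
    Real.le_sqrt_of_sq_le (by linarith [sq_nonneg ζ])
  have h4 : ζ ≤ Real.sqrt (L ^ 2 * η ^ 2 / N + N * η ^ 2 + ζ ^ 2) :=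
    Real.le_sqrt_of_sq_le (by linarith [sq_nonneg η])
  linarith

/-- The square root of the optimality gap decays geometrically up to a multiple of the variations
`η + ζ`, from an initial value controlled by the initial errors alone. -/
theorem exists_rootGap_bound {N : ℕ} (hN : 0 < N) {𝓔 : Digraph (Fin N)}
    {W : Matrix (Fin N) (Fin N) ℝ} (hW : Compliant 𝓔 W) (haper : Aperiodic 𝓔)
    (hsums : RowColSumsOne W) {L q β₁ ε G : ℝ} (hL : 0 < L) (hq : 0 < q) (hβ₁ : 0 < β₁)
    (hβ₁' : β₁ < 1) (hε : 0 < ε) (hG : 0 < G) :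
    ∃ αmax c T : ℝ, 0 < αmax ∧ 0 < c ∧ 0 < T ∧ ∀ α : ℝ, 0 < α → α < αmax →
      α * c ≤ 1 / 2 ∧
      ∀ (n : ℕ) (β₂ : ℝ), 0 < β₂ → β₂ < 1 →
      ∀ (f : Fin N → ℕ → Vec n → ℝ) (xs : ℕ → Vec n) (η ζ : ℝ), 0 < η → 0 < ζ →
        (∀ i t, LipschitzGradient L (f i t)) → (∀ i t, StrongConvexOn Set.univ q (f i t)) →
        (∀ t, IsMinOn (cost f t) Set.univ (xs t)) → BoundedVariations f xs η ζ →
        ∀ (x₀ : Fin N → Vec n) (t : ℕ),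
          rootGap f xs t (iterate W ⟨α, β₁, β₂, ε, G⟩ f x₀ t) ≤
            (1 - α * c) ^ t * (Real.sqrt (L / 2) *
              ‖errorVec (iterate W ⟨α, β₁, β₂, ε, G⟩ f x₀ 0) (xs 0)‖)
            + T * (η + ζ) / (α * c) := by
  obtain ⟨τ, C, hτ0, hτ1, hC, hP⟩ := exists_mixing_seminorm hN hW haper hsums
  have h1τ : 0 < 1 - τ := by linarith
  obtain ⟨kS, hkS⟩ : ∃ kS, kS = 2 / (1 - τ) := ⟨_, rfl⟩
  obtain ⟨kX, hkX⟩ : ∃ kX, kX = 4 * L * (kS * C + 1) / (1 - τ) := ⟨_, rfl⟩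
  have hkS1 : 1 ≤ kS := by rw [hkS, le_div_iff₀ h1τ]; linarith
  have hkS' : kS * (1 - τ) = 2 := by rw [hkS]; field_simp
  have hkX' : kX * (1 - τ) = 4 * L * (kS * C + 1) := by rw [hkX]; field_simp
  have hkXL : L ≤ kX := by
    rw [hkX, le_div_iff₀ h1τ]
    have : 0 ≤ L * (kS * C) := by positivity
    nlinarith
  have hkX0 : 0 < kX := by linarith
  obtain ⟨δ, hδdef⟩ : ∃ δ, δ = min (1 - β₁) ((1 - τ) / 2) := ⟨_, rfl⟩
  have hδ0 : 0 < δ := by rw [hδdef]; exact lt_min (by linarith) (by linarith)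
  have hδ : δ ≤ 1 - β₁ := hδdef ▸ min_le_left _ _
  have hδ' : δ ≤ (1 - τ) / 2 := hδdef ▸ min_le_right _ _
  obtain ⟨d₀, hd₀⟩ : ∃ d₀, d₀ = 1 / Real.sqrt (G + ε) := ⟨_, rfl⟩
  obtain ⟨d₁, hd₁⟩ : ∃ d₁, d₁ = 1 / Real.sqrt ε := ⟨_, rfl⟩
  have hd₀0 : 0 < d₀ := by rw [hd₀]; positivity
  have hd₁0 : 0 < d₁ := by rw [hd₁]; positivity
  obtain ⟨k, hk⟩ : ∃ k, k = L * Real.sqrt (2 / q) := ⟨_, rfl⟩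
  have hk0 : 0 ≤ k := by rw [hk]; positivity
  obtain ⟨A, hA⟩ : ∃ A, A = (k + L + 1) * d₁ := ⟨_, rfl⟩
  obtain ⟨B, hB⟩ : ∃ B, B = (kX * C + (kS * C + 1) * L) * d₁ := ⟨_, rfl⟩
  have hA0 : 0 < A := by rw [hA]; positivity
  have hB0 : 0 < B := by rw [hB]; positivity
  obtain ⟨D, hD⟩ : ∃ D, D = (kS * C + 1) + (Real.sqrt (2 / q) + L + 1) := ⟨_, rfl⟩
  have hD0 : 0 < D := by rw [hD]; positivity
  obtain ⟨c, hc⟩ : ∃ c, c = d₀ * q / 2 := ⟨_, rfl⟩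
  have hc0 : 0 < c := by rw [hc]; positivity
  obtain ⟨s, hs⟩ : ∃ s, s = Real.sqrt (L / 2) := ⟨_, rfl⟩
  have hs0 : 0 < s := by rw [hs]; positivity
  -- Fraction of `‖y₀‖` that the initial distance from the minimizer can reach.
  obtain ⟨θ, hθ⟩ : ∃ θ, θ = 1 / Real.sqrt (1 + (q / (1 + L * C)) ^ 2) := ⟨_, rfl⟩
  have hθ1 : θ < 1 := by
    have : 0 < (q / (1 + L * C)) ^ 2 := by positivity
    rw [hθ, div_lt_one (by positivity)]
    exact Real.lt_sqrt_of_sq_lt (by linarith)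
  obtain ⟨C₀, hC₀⟩ : ∃ C₀, C₀ = kS * C + 1 + kX * C := ⟨_, rfl⟩
  have hC₀0 : 0 < C₀ := by rw [hC₀]; positivity
  -- The first bound closes the feedback loop of the coupled system; the second fits `K F₀` into the
  -- slack `s (1 - θ) ‖y₀‖`.
  obtain ⟨K, hK⟩ : ∃ K, K = min (c / (2 * (B * k + 1))) (s * (1 - θ) / C₀) := ⟨_, rfl⟩
  have hBk : 0 ≤ B * k := by positivity
  have hK0 : 0 < K := by
    rw [hK]
    exact lt_min (by positivity) (div_pos (mul_pos hs0 (by linarith)) hC₀0)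
  have hKc : K * (B * k) ≤ c / 2 := by
    have h1 : K ≤ c / (2 * (B * k + 1)) := hK ▸ min_le_left _ _
    rw [le_div_iff₀ (by positivity)] at h1
    linarith
  have hKs : K * C₀ ≤ s * (1 - θ) := by
    have h1 : K ≤ s * (1 - θ) / C₀ := hK ▸ min_le_right _ _
    rwa [le_div_iff₀ hC₀0] at h1
  -- The three bounds on `α` keep the descent factor at least `1/2`, control the curvature term, and
  -- let the contraction of `F` dominate the coupling. Half of the descent rate `c` survives.
  refine ⟨min (1 / (d₀ * q)) (min (d₀ / (2 * L * d₁ ^ 2)) (K * δ / (A + K * B + K * (c / 2)))),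
    c / 2, (1 + K) * D, by positivity, by positivity, by positivity, fun α hα hαmax => ?_⟩
  rw [lt_min_iff, lt_min_iff, lt_div_iff₀ (by positivity), lt_div_iff₀ (by positivity),
    lt_div_iff₀ (by positivity)] at hαmax
  obtain ⟨hα₁, hα₂, hα₃⟩ := hαmax
  have hαc : α * c ≤ 1 := by rw [hc]; linarith
  refine ⟨by linarith, ?_⟩
  intro n β₂ hβ₂ hβ₂' f xs η ζ hη hζ hf hconv hmin hvar x₀ t
  obtain ⟨P, hmix, hPC, hdev, hPcenter⟩ := hP n
  have hPD : ∀ u, P u ≤ C * disagreement u := fun u => by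
    rw [hPcenter u]
    exact (hPC _).trans (mul_le_mul_of_nonneg_left (norm_center_le_disagreement u) hC.le)
  set p : Params := ⟨α, β₁, β₂, ε, G⟩ with hp
  set z := iterate W p f x₀ with hz
  have hv : ∀ t i k, 0 ≤ nextV p (z t) i k ∧ nextV p (z t) i k ≤ p.G := fun t =>
    nextV_mem hβ₂ hβ₂' hG (iterate_v_nonneg hβ₂ hβ₂' hG t)
  have htrack : ∀ t, avg (z t).s = avg fun i => gradient (f i t) ((z t).x i) :=
    avg_iterate_s hsums.1
  have hm0 : (z 0).m = 0 := rfl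
  set y := ‖errorVec (z 0) (xs 0)‖
  have hy : 0 ≤ y := norm_nonneg _
  have hF0 : fastError P kS kX (z 0) ≤ C₀ * y := by
    rw [hC₀]
    exact fastError_initial_le (by linarith) hkX0.le hC.le hPD hm0 (xs 0)
  have ha0 : rootGap f xs 0 (z 0) ≤ s * (θ * y) := by
    refine (rootGap_le hN hL (fun i => hf i 0) (hmin 0)).trans ?_
    rw [← hs]
    refine mul_le_mul_of_nonneg_left ?_ hs0.le
    rw [hθ, one_div, le_inv_mul_iff₀ (by positivity)]
    exact norm_avg_sub_minimizer_initial_le hN hL hq hC.le hdev hPD hm0 (fun i => hf i 0)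
      (fun i => hconv i 0) (hmin 0) (htrack 0)
  have hU0 : rootGap f xs 0 (z 0) + K * fastError P kS kX (z 0) ≤ s * y := by
    have h1 := mul_le_mul_of_nonneg_left hF0 hK0.le
    have h2 := mul_le_mul_of_nonneg_right hKs hy
    linarith
  have hmain := coupled_system_bound (a := fun t => rootGap f xs t (z t))
    (F := fun t => fastError P kS kX (z t)) (α := α) (c := c) (δ := δ) (A := A) (B := B) (k := k)
    (D := D) (K := K) (e := η + ζ) hα hc0 hK0 hD0.le (by positivity)
    (fun t => Real.sqrt_nonneg _) (fun t => fastError_nonneg (by linarith) hkX0.le)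
    (by linarith) hKc hα₃.le
    (fun t => by
      have h := fastError_step_le (p := p) hN hsums hdev hmix hPC hC.le hτ1 hL hq hα hβ₁ hβ₁' hε
        hkS' hkX' hkS1 hkXL hδ hδ' (hv t) (fun i => hf i t) (fun i => hconv i t) (hmin t) (htrack t)
        (hvar.1 t)
      have h1 : (kS * C + 1) * η ≤ D * (η + ζ) := by
        rw [hD]
        gcongr <;> linarith [Real.sqrt_nonneg (2 / q)]
      rw [← hk, show 1 / Real.sqrt p.ε = d₁ from hd₁.symm, ← hB] at h
      exact h.trans (add_le_add_right h1 _))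
    (fun t => by
      have h := rootGap_step_le (p := p) hN hsums hdev hL hq hη.le hζ.le hα hβ₁ hβ₁' hε
        (by rw [show 1 / Real.sqrt (p.G + p.ε) = d₀ from hd₀.symm]; exact hα₁.le)
        (by
          rw [show 1 / Real.sqrt (p.G + p.ε) = d₀ from hd₀.symm,
            show 1 / Real.sqrt p.ε = d₁ from hd₁.symm]
          exact hα₂.le)
        hkS1 hkXL (hv t) hf hconv hmin (htrack t) (hvar.1 t) (hvar.2 t)
      have h1 : (Real.sqrt (2 / q) + L + 1) * (η + ζ) ≤ D * (η + ζ) := by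
        have : 0 ≤ kS * C := by positivity
        exact mul_le_mul_of_nonneg_right (by rw [hD]; linarith) (by positivity)
      rw [← hk, show 1 / Real.sqrt p.ε = d₁ from hd₁.symm,
        show 1 / Real.sqrt (p.G + p.ε) = d₀ from hd₀.symm, ← hA, ← hc] at h
      exact h.trans (add_le_add_right h1 _)) t
  rw [← hs]
  refine hmain.trans ?_
  rw [← mul_div_assoc]
  exact add_le_add_left (mul_le_mul_of_nonneg_left hU0 (pow_nonneg (by linarith) t)) _

end GTAdam

end

theorem theorem1 {N : ℕ} (hN : 0 < N)
    (𝓔 : Digraph (Fin N)) (W : Matrix (Fin N) (Fin N) ℝ)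
    (hW : GTAdam.Compliant 𝓔 W) (hconn : GTAdam.StronglyConnected 𝓔)
    (haper : GTAdam.Aperiodic 𝓔) (hsums : GTAdam.RowColSumsOne W)
    (L q β₁ ε G : ℝ) (hL : 0 < L) (hq : 0 < q) (hβ₁ : 0 < β₁) (hβ₁' : β₁ < 1)
    (hε : 0 < ε) (hG : 0 < G) :
    ∃ αmax : ℝ, 0 < αmax ∧ ∀ α : ℝ, 0 < α → α < αmax →
      ∃ ρ : ℝ, 0 < ρ ∧ ρ < 1 ∧
        ∀ (n : ℕ) (β₂ : ℝ), 0 < β₂ → β₂ < 1 →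
        ∀ (f : Fin N → ℕ → GTAdam.Vec n → ℝ) (xs : ℕ → GTAdam.Vec n) (η ζ : ℝ),
          0 < η → 0 < ζ →
          (∀ i t, GTAdam.LipschitzGradient L (f i t)) →
          (∀ i t, StrongConvexOn Set.univ q (f i t)) →
          (∀ t, IsMinOn (GTAdam.cost f t) Set.univ (xs t)) →
          GTAdam.BoundedVariations f xs η ζ →
          ∀ (x₀ : Fin N → GTAdam.Vec n) (z : ℕ → GTAdam.State N n) (y₀ Q : ℝ),
            z = GTAdam.iterate W ⟨α, β₁, β₂, ε, G⟩ f x₀ →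
            y₀ = ‖GTAdam.errorVec (z 0) (xs 0)‖ →
            Q = L ^ 2 * η ^ 2 / N + N * η ^ 2 + ζ ^ 2 →
            ∀ t : ℕ,
              GTAdam.cost f t (GTAdam.avg (z t).x) - GTAdam.cost f t (xs t) ≤
                L / 2 * (ρ ^ (2 * t) * y₀ ^ 2 + 2 * ρ ^ t * (y₀ * Real.sqrt Q / (1 - ρ))
                  + Q / (1 - ρ) ^ 2) := by
  obtain ⟨αmax, c, T, hαmax, hc, hT, hbound⟩ :=
    GTAdam.exists_rootGap_bound hN hW haper hsums hL hq hβ₁ hβ₁' hε hG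
  refine ⟨αmax, hαmax, fun α hα hα' => ?_⟩
  obtain ⟨hαc, hbound⟩ := hbound α hα hα'
  have hs : 0 < Real.sqrt (L / 2) := by positivity
  -- With `ρ = 1 - μ`, the second entry turns the drift `2 T √Q / (αc)` into at most `√(L/2) √Q /
  -- μ`; the first keeps `ρ` at least the rate already obtained.
  have hμ : 0 < min (α * c) (Real.sqrt (L / 2) * (α * c) / (2 * T)) :=
    lt_min (by positivity) (by positivity)
  have hμ₁ := min_le_left (α * c) (Real.sqrt (L / 2) * (α * c) / (2 * T))
  have hμ₂ := min_le_right (α * c) (Real.sqrt (L / 2) * (α * c) / (2 * T))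
  generalize min (α * c) (Real.sqrt (L / 2) * (α * c) / (2 * T)) = μ at hμ hμ₁ hμ₂
  refine ⟨1 - μ, by linarith, by linarith, ?_⟩
  intro n β₂ hβ₂ hβ₂' f xs η ζ hη hζ hf hconv hmin hvar x₀ z y₀ Q hz hy₀ hQ t
  subst hz
  have h1 := hbound n β₂ hβ₂ hβ₂' f xs η ζ hη hζ hf hconv hmin hvar x₀ t
  rw [← hy₀] at h1
  have hy : 0 ≤ y₀ := hy₀ ▸ norm_nonneg _
  have hQ0 : 0 ≤ Q := by rw [hQ]; positivity
  have h2 : η + ζ ≤ 2 * Real.sqrt Q := hQ ▸ GTAdam.add_le_two_mul_sqrt hN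
  have h3 : T * (η + ζ) / (α * c) ≤ Real.sqrt (L / 2) * (Real.sqrt Q / μ) := by
    rw [le_div_iff₀ (by positivity)] at hμ₂
    rw [← mul_div_assoc, div_le_div_iff₀ (by positivity) hμ]
    have i1 := mul_le_mul_of_nonneg_left h2 (by positivity : 0 ≤ T * μ)
    have i2 := mul_le_mul_of_nonneg_right hμ₂ (Real.sqrt_nonneg Q)
    linarith
  have h4 : (1 - α * c) ^ t * (Real.sqrt (L / 2) * y₀) ≤
      (1 - μ) ^ t * (Real.sqrt (L / 2) * y₀) :=
    mul_le_mul_of_nonneg_right (pow_le_pow_left₀ (by linarith) (by linarith) t) (by positivity)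
  set x := GTAdam.avg (GTAdam.iterate W ⟨α, β₁, β₂, ε, G⟩ f x₀ t).x with hx
  have h5 : Real.sqrt (GTAdam.cost f t x - GTAdam.cost f t (xs t)) ≤
      Real.sqrt (L / 2) * ((1 - μ) ^ t * y₀ + Real.sqrt Q / μ) := by
    have : Real.sqrt (GTAdam.cost f t x - GTAdam.cost f t (xs t)) ≤ _ := h1
    linarith
  -- Squaring the bound on the root yields the three terms of the claim.
  have h6 := (Real.sqrt_le_iff.1 h5).2
  rw [mul_pow, Real.sq_sqrt (by positivity)] at h6
  refine h6.trans_eq ?_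
  rw [sub_sub_cancel, add_sq, div_pow, Real.sq_sqrt hQ0]
  ring
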